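/- For $c>0$ let $M^2(c)=\{x\in\mathbb E^3:\langle x,x\rangle=1/c\}$ be the sphere in Euclidean space, and for $c<0$ let $M^2(c)=\{x\in\mathbb R^3_1:\langle x,x\rangle_1=1/c,\ x_1>0\}$ be the upper sheet of the hyperboloid in Minkowski space, with $\langle x,y\rangle_1=-x_1y_1+x_2y_2+x_3y_3$, each with the induced metric. Let $\times$ be the cross product of $\mathbb E^3$ and $\boxtimes$ the Lorentzian cross product, determined by $\langle x\boxtimes y,z\rangle_1=\det(x,y,z)$. Let $c_1,c_2$ be real numbers with $c_1c_2>0$, let $\widetilde g$ be the product metric of $M^2(c_1)\times M^2(c_2)$, and let $F(X_1+X_2)=X_1-X_2$, where $X_1,X_2$ are tangent to the first and second factor. Let $\psi:M^2\to M^2(c_1)\times M^2(c_2)$ be a smooth immersion of a surface which is totally geodesic, i.e. whose second fundamental form vanishes. For tangent vectors $X$ of $M^2$ let $fX$ be the tangential component of $FX$, and suppose that at every point both eigenvalues $\lambda_1\le\lambda_2$ of the symmetric endomorphism $f$ are equal to $\frac{c_2-c_1}{c_1+c_2}$. Then every point of $M^2$ has a neighbourhood with local coordinates $(u,v)$ on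 which, after composing $\psi$ with an isometry of $M^2(c_1)\times M^2(c_2)$, $\psi$ is given by $$\Big(\cos(ku)\widetilde f(v)+\sin(ku)\sqrt{\tfrac{c_1+c_2}{c_2}}\,\widetilde f(v)\times\widetilde f'(v),\ \cos(ku)\overline f(v)+\sin(ku)\sqrt{\tfrac{c_1+c_2}{c_1}}\,\overline f(v)\times\overline f'(v)\Big),\quad k=\sqrt{\tfrac{c_1c_2}{c_1+c_2}},$$ if $c_1,c_2>0$, and by $$\Big(\cosh(ku)\widetilde f(v)+\sinh(ku)\sqrt{\tfrac{c_1+c_2}{c_2}}\,\widetilde f(v)\boxtimes\widetilde f'(v),\ \cosh(ku)\overline f(v)+\sinh(ku)\sqrt{\tfrac{c_1+c_2}{c_1}}\,\overline f(v)\boxtimes\overline f'(v)\Big),\quad k=\sqrt{-\tfrac{c_1c_2}{c_1+c_2}},$$ if $c_1,c_2<0$. In both cases $\widetilde f$ and $\overline f$ are geodesics of $M^2(c_1)$ and $M^2(c_2)$ (great circles if $c_1,c_2>0$), of constant speeds $\sqrt{\frac{c_2}{c_1+c_2}}$ and $\sqrt{\frac{c_1}{c_1+c_2}}$, respectively. 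-/

import Mathlib

open scoped ContDiff Manifold

namespace SpaceFormProduct

/-- The vector space `ℝ³` in which the two-dimensional space forms are realized. Only its vector
space structure, its topology and its smooth structure are used; scalar products are given by
`form`. -/
abbrev V : Type := Fin 3 → ℝ

/-- The vector space `ℝ⁶ = ℝ³ × ℝ³` containing the product of the two space forms. -/
abbrev A : Type := V × V

/-- The coordinate plane `ℝ²`. -/
abbrev E2 : Type := EuclideanSpace ℝ (Fin 2)

/-- The scalar product of `ℝ³` used for curvature `c`: the Euclidean one if `c > 0`, and the
Lorentzian one `-x₀y₀ + x₁y₁ + x₂y₂` if `c < 0`. -/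
noncomputable def form (c : ℝ) (x y : V) : ℝ :=
  (if 0 < c then 1 else -1) * (x 0 * y 0) + x 1 * y 1 + x 2 * y 2

/-- The space form `M²(c)`, `c ≠ 0`: the sphere of radius `1/√c` in Euclidean space if `c > 0`, the
upper sheet of the hyperboloid `⟨x,x⟩ = 1/c` in Minkowski space if `c < 0`. -/
def spaceForm (c : ℝ) : Set V := {x | form c x x = 1 / c ∧ (c < 0 → 0 < x 0)}

/-- The tangent space of `M²(c)` at `p`. -/
def spaceFormTangent (c : ℝ) (p : V) : Set V := {v | form c p v = 0}

/-- The orthogonal projection of `ℝ³` onto the tangent space of `M²(c)` at `p ∈ M²(c)`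
(recall that `⟨p,p⟩ = 1/c`). -/
noncomputable def tangentProj (c : ℝ) (p w : V) : V := w - (c * form c p w) • p

/-- The product `M²(c₁) × M²(c₂)`. -/
def prodForm (c₁ c₂ : ℝ) : Set A := spaceForm c₁ ×ˢ spaceForm c₂

/-- The tangent space of `M²(c₁) × M²(c₂)` at `p`. -/
def prodTangent (c₁ c₂ : ℝ) (p : A) : Set A :=
  spaceFormTangent c₁ p.1 ×ˢ spaceFormTangent c₂ p.2

/-- The product metric. -/
noncomputable def metric (c₁ c₂ : ℝ) (X Y : A) : ℝ := form c₁ X.1 Y.1 + form c₂ X.2 Y.2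

theorem metric_add_left (c₁ c₂ : ℝ) (X Y Z : A) :
    metric c₁ c₂ (X + Y) Z = metric c₁ c₂ X Z + metric c₁ c₂ Y Z := by
  simp only [metric, form, Prod.fst_add, Prod.snd_add, Pi.add_apply]
  ring

theorem metric_smul_left (c₁ c₂ a : ℝ) (X Z : A) :
    metric c₁ c₂ (a • X) Z = a * metric c₁ c₂ X Z := by
  simp only [metric, form, Prod.smul_fst, Prod.smul_snd, Pi.smul_apply, smul_eq_mul]
  ring

/-- The product structure `F (X₁ + X₂) = X₁ - X₂`. -/
def productStructure : A →ₗ[ℝ] A := LinearMap.prodMap LinearMap.id (-LinearMap.id)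

/-- Gram matrix, in the standard basis of `ℝ²`, of the metric induced by a linear map
`D : ℝ² → ℝ⁶` (the differential of an immersion). -/
noncomputable def gram (c₁ c₂ : ℝ) (D : E2 →L[ℝ] A) : Matrix (Fin 2) (Fin 2) ℝ :=
  Matrix.of fun i j => metric c₁ c₂ (D (EuclideanSpace.single i 1)) (D (EuclideanSpace.single j 1))

/-- The tangential component of `Z`: the vector `T` of `ℝ²` such that `Z - D T` is orthogonal to the
tangent plane `D(ℝ²)`, see `metric_sub_tangentialPart`. -/
noncomputable def tangentialPart (c₁ c₂ : ℝ) (D : E2 →L[ℝ] A) : A →ₗ[ℝ] E2 where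
  toFun Z := WithLp.toLp 2
    ((gram c₁ c₂ D)⁻¹.mulVec fun i => metric c₁ c₂ Z (D (EuclideanSpace.single i 1)))
  map_add' X Y := by
    rw [← WithLp.toLp_add, ← Matrix.mulVec_add]
    congr 2
    funext i
    exact metric_add_left c₁ c₂ X Y _
  map_smul' a X := by
    rw [RingHom.id_apply, ← WithLp.toLp_smul, ← Matrix.mulVec_smul]
    congr 2
    funext i
    exact metric_smul_left c₁ c₂ a X _

theorem metric_sub_tangentialPart (c₁ c₂ : ℝ) (D : E2 →L[ℝ] A)
    (hD : (gram c₁ c₂ D).det ≠ 0) (Z : A) (Y : E2) :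
    metric c₁ c₂ (Z - D (tangentialPart c₁ c₂ D Z)) (D Y) = 0 := by
  have e : ∀ W : E2, D W = W 0 • D (EuclideanSpace.single 0 1)
      + W 1 • D (EuclideanSpace.single 1 1) := by
    intro W
    rw [← map_smul, ← map_smul, ← map_add]
    congr 1
    ext i
    fin_cases i <;> simp
  have key := congrArg (fun M => M.mulVec fun i => metric c₁ c₂ Z (D (EuclideanSpace.single i 1)))
    (Matrix.mul_nonsing_inv (gram c₁ c₂ D) (isUnit_iff_ne_zero.mpr hD))
  simp only [← Matrix.mulVec_mulVec, Matrix.one_mulVec] at key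
  have k0 := congrFun key 0
  have k1 := congrFun key 1
  set T := tangentialPart c₁ c₂ D Z with hT
  have t : ((gram c₁ c₂ D)⁻¹.mulVec fun i => metric c₁ c₂ Z (D (EuclideanSpace.single i 1)))
      = fun i => T i := rfl
  rw [t] at k0 k1
  rw [e T, e Y]
  simp only [Matrix.mulVec, dotProduct, gram, Matrix.of_apply, Fin.sum_univ_two, metric,
    form] at k0 k1
  simp only [metric, form, Prod.fst_add, Prod.snd_add, Prod.fst_sub, Prod.snd_sub, Prod.smul_fst,
    Prod.smul_snd, Pi.add_apply, Pi.sub_apply, Pi.smul_apply, smul_eq_mul]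
  linear_combination -(Y 0) * k0 - (Y 1) * k1

/-- The endomorphism `f` of a tangent plane: `f X` is the tangential component of `F X`, the plane
being the image of `D`. -/
noncomputable def tangentEndo (c₁ c₂ : ℝ) (D : E2 →L[ℝ] A) : E2 →ₗ[ℝ] E2 :=
  tangentialPart c₁ c₂ D ∘ₗ productStructure ∘ₗ D.toLinearMap

/-- The eigenvalues of `f`, with multiplicity. -/
noncomputable def eigenvaluesF (c₁ c₂ : ℝ) (D : E2 →L[ℝ] A) : Multiset ℝ :=
  (tangentEndo c₁ c₂ D).charpoly.roots

/-- For a map `Φ` from an open set of `ℝ²` to `M²(c₁) × M²(c₂)`, the covariant derivative, in the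
product, of the vector field `dΦ(Y)` along `Φ` in the direction `X` at the point `y` (`X`, `Y`
constant): the projection of the ordinary derivative onto the tangent space of the product. -/
noncomputable def covDeriv (c₁ c₂ : ℝ) (Φ : E2 → A) (y X Y : E2) : A :=
  (tangentProj c₁ (Φ y).1 (fderiv ℝ (fun z => fderiv ℝ Φ z Y) y X).1,
   tangentProj c₂ (Φ y).2 (fderiv ℝ (fun z => fderiv ℝ Φ z Y) y X).2)

/-- The second fundamental form `σ(X, Y)` of a parametrized surface `Φ` at the point `y`: the
component normal to the surface of the covariant derivative in `M²(c₁) × M²(c₂)`. -/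
noncomputable def secondFundamentalForm (c₁ c₂ : ℝ) (Φ : E2 → A) (y X Y : E2) : A :=
  covDeriv c₁ c₂ Φ y X Y
    - fderiv ℝ Φ y (tangentialPart c₁ c₂ (fderiv ℝ Φ y) (covDeriv c₁ c₂ Φ y X Y))

section Surface

variable {M : Type*} [TopologicalSpace M] [ChartedSpace E2 M]

/-- `ψ` is a smooth immersion of the surface `M` into `M²(c₁) × M²(c₂)`. -/
structure IsImmersedSurface (c₁ c₂ : ℝ) (ψ : M → A) : Prop where
  mem : ∀ p, ψ p ∈ prodForm c₁ c₂
  smooth : ContMDiff (𝓡 2) 𝓘(ℝ, A) ∞ ψ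
  immersive : ∀ p, Function.Injective (mfderiv (𝓡 2) 𝓘(ℝ, A) ψ p)

/-- The second fundamental form of `ψ` vanishes, in all the charts of the atlas of `M`. -/
def IsTotallyGeodesic (c₁ c₂ : ℝ) (ψ : M → A) : Prop :=
  ∀ χ ∈ atlas E2 M, ∀ y ∈ χ.target, ∀ X Y : E2,
    secondFundamentalForm c₁ c₂ (ψ ∘ χ.symm) y X Y = 0

/-- The eigenvalues `λ₁ ≤ λ₂` of `f` at the point `p` of the surface `ψ`, as a multiset. -/
noncomputable def eigenvaluesAt (c₁ c₂ : ℝ) (ψ : M → A) (p : M) : Multiset ℝ :=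
  eigenvaluesF c₁ c₂ (mfderiv (𝓡 2) 𝓘(ℝ, A) ψ p)

/-- Near `p`, the surface `ψ` coincides with the surface parametrized by `S` (a function of `u` and
`v`) in suitable local coordinates `(u, v)` of `M` defined around `p`. -/
def IsLocallyGivenBy [IsManifold (𝓡 2) ∞ M] (ψ : M → A) (p : M) (S : ℝ → ℝ → A) : Prop :=
  ∃ χ ∈ IsManifold.maximalAtlas (𝓡 2) ∞ M, p ∈ χ.source ∧
    ∀ q ∈ χ.source, ψ q = S (χ q 0) (χ q 1)

end Surface

/-- (Riemannian) isometries of `M²(c₁) × M²(c₂)` onto itself. As the product is a closed submanifold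
of `ℝ⁶`, its smooth self-maps are the restrictions of smooth maps of `ℝ⁶`. -/
structure IsIsometry (c₁ c₂ : ℝ) (τ : A → A) : Prop where
  smooth : ContDiff ℝ ∞ τ
  bijOn : Set.BijOn τ (prodForm c₁ c₂) (prodForm c₁ c₂)
  metric_fderiv : ∀ p ∈ prodForm c₁ c₂, ∀ X ∈ prodTangent c₁ c₂ p, ∀ Y ∈ prodTangent c₁ c₂ p,
    metric c₁ c₂ (fderiv ℝ τ p X) (fderiv ℝ τ p Y) = metric c₁ c₂ X Y

/-- Geodesics `ℝ → M²(c)`: smooth curves with vanishing covariant acceleration. -/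
structure IsGeodesic (c : ℝ) (α : ℝ → V) : Prop where
  smooth : ContDiff ℝ ∞ α
  mem : ∀ t, α t ∈ spaceForm c
  acceleration : ∀ t, tangentProj c (α t) (deriv (deriv α) t) = 0

/-- The curve `α` in `M²(c)` has constant speed `r`. -/
def HasConstantSpeed (c : ℝ) (α : ℝ → V) (r : ℝ) : Prop :=
  ∀ t, Real.sqrt (form c (deriv α t) (deriv α t)) = r

/-- The cross product of Euclidean space. -/
def euclCross (x y : V) : V := crossProduct x y

/-- The Lorentzian cross product of Minkowski space, the first coordinate being timelike. It is
characterized by `⟨x ⊠ y, z⟩ = det (x, y, z)`. -/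
def lorentzCross (x y : V) : V :=
  ![-(x 1 * y 2 - x 2 * y 1), x 2 * y 0 - x 0 * y 2, x 0 * y 1 - x 1 * y 0]

/-- The surface built from curves `α`, `β` in the two factors when `c₁, c₂ > 0`. -/
noncomputable def sphericalSurface (c₁ c₂ : ℝ) (α β : ℝ → V) (u v : ℝ) : A :=
  (Real.cos (Real.sqrt (c₁ * c₂ / (c₁ + c₂)) * u) • α v
      + (Real.sin (Real.sqrt (c₁ * c₂ / (c₁ + c₂)) * u) * Real.sqrt ((c₁ + c₂) / c₂))
        • euclCross (α v) (deriv α v),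
   Real.cos (Real.sqrt (c₁ * c₂ / (c₁ + c₂)) * u) • β v
      + (Real.sin (Real.sqrt (c₁ * c₂ / (c₁ + c₂)) * u) * Real.sqrt ((c₁ + c₂) / c₁))
        • euclCross (β v) (deriv β v))

/-- The surface built from curves `α`, `β` in the two factors when `c₁, c₂ < 0`. -/
noncomputable def hyperbolicSurface (c₁ c₂ : ℝ) (α β : ℝ → V) (u v : ℝ) : A :=
  (Real.cosh (Real.sqrt (-(c₁ * c₂ / (c₁ + c₂))) * u) • α v
      + (Real.sinh (Real.sqrt (-(c₁ * c₂ / (c₁ + c₂))) * u) * Real.sqrt ((c₁ + c₂) / c₂))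
        • lorentzCross (α v) (deriv α v),
   Real.cosh (Real.sqrt (-(c₁ * c₂ / (c₁ + c₂))) * u) • β v
      + (Real.sinh (Real.sqrt (-(c₁ * c₂ / (c₁ + c₂))) * u) * Real.sqrt ((c₁ + c₂) / c₁))
        • lorentzCross (β v) (deriv β v))

end SpaceFormProduct

namespace SpaceFormProduct

/-! The endomorphism `f` is symmetric for a definite metric, so a double eigenvalue `l` forces `f =
l · id`. For `l = (c₂ - c₁) / (c₁ + c₂)` this says that the metrics `g₁`, `g₂` induced by the two
projections satisfy `c₁ g₁ = c₂ g₂` (`form_fst_eq_form_snd`). Both projections are then immersions.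

Each projection carries a moving frame of `ℝ³`: its position vector and its differential. Total
geodesy makes the covariant derivative of `dΦ(Y)` equal to `dΦ(T)` with one `T` for both factors,
and the normal terms `cᵢ gᵢ` agree. The two frames thus solve the same linear system and differ by a
constant linear map `Q` (`frames_congruent`, `exists_homothety`). So the surface is locally the
graph of a linear homothety, and a linear isometry of the second factor turns `Q` into
multiplication by `s = √(c₁ / c₂)`.

It remains to parametrize an open piece of `M²(c₁)`. Along a geodesic `α` the vector `α × α'` is
constant, so the required formula is `C(ku) α(v) + S(ku) N` with a fixed `N`: Fermi coordinates,
which have an explicit smooth inverse (`IsTrig.fermi_spec`). A sign `ε = ±1` treats sphere and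
hyperboloid together. -/

/-! ### Scalar products and causal character -/

theorem form_comm (c : ℝ) (x y : V) : form c x y = form c y x := by
  simp only [form]; ring

theorem form_add_left (c : ℝ) (x y z : V) : form c (x + y) z = form c x z + form c y z := by
  simp only [form, Pi.add_apply]; ring

theorem form_add_right (c : ℝ) (x y z : V) : form c x (y + z) = form c x y + form c x z := by
  simp only [form, Pi.add_apply]; ring

theorem form_smul_left (c a : ℝ) (x y : V) : form c (a • x) y = a * form c x y := by
  simp only [form, Pi.smul_apply, smul_eq_mul]; ring

theorem form_smul_right (c a : ℝ) (x y : V) : form c x (a • y) = a * form c x y := by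
  simp only [form, Pi.smul_apply, smul_eq_mul]; ring

theorem form_zero_left (c : ℝ) (y : V) : form c 0 y = 0 := by simp [form]

theorem form_zero_right (c : ℝ) (y : V) : form c y 0 = 0 := by simp [form]

/-- The scalar product only depends on the sign of the curvature. -/
theorem form_congr {c₁ c₂ : ℝ} (hc : 0 < c₁ * c₂) : form c₂ = form c₁ := by
  funext x y
  have : 0 < c₂ ↔ 0 < c₁ := by
    constructor <;> intro h <;> nlinarith
  simp only [form, this]

/-- `form c` as a continuous bilinear map. -/
noncomputable def formL (c : ℝ) : V →L[ℝ] V →L[ℝ] ℝ :=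
  (if 0 < c then (1 : ℝ) else -1) •
      (ContinuousLinearMap.proj (R := ℝ) (φ := fun _ : Fin 3 => ℝ) 0).smulRight
        (ContinuousLinearMap.proj (R := ℝ) (φ := fun _ : Fin 3 => ℝ) 0)
    + (ContinuousLinearMap.proj (R := ℝ) (φ := fun _ : Fin 3 => ℝ) 1).smulRight
        (ContinuousLinearMap.proj (R := ℝ) (φ := fun _ : Fin 3 => ℝ) 1)
    + (ContinuousLinearMap.proj (R := ℝ) (φ := fun _ : Fin 3 => ℝ) 2).smulRight
        (ContinuousLinearMap.proj (R := ℝ) (φ := fun _ : Fin 3 => ℝ) 2)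

theorem formL_apply (c : ℝ) (x y : V) : formL c x y = form c x y := by
  by_cases h : 0 < c <;> simp [formL, form, h]

/-- Tangent vectors of a space form are spacelike. -/
theorem form_self_pos {c : ℝ} (hc : c ≠ 0) {p v : V} (hp : p ∈ spaceForm c)
    (hv : form c p v = 0) (hv0 : v ≠ 0) : 0 < form c v v := by
  obtain ⟨hp1, hp2⟩ := hp
  have hne : v 0 ≠ 0 ∨ v 1 ≠ 0 ∨ v 2 ≠ 0 := by
    by_contra! h
    exact hv0 (by ext i; fin_cases i <;> simp [h.1, h.2.1, h.2.2])
  rcases lt_or_gt_of_ne hc with h | h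
  · have hp0 := hp2 h
    simp only [form, not_lt.mpr h.le, if_false] at *
    have hcinv : 1 / c < 0 := one_div_neg.mpr h
    have key : p 0 * v 0 = p 1 * v 1 + p 2 * v 2 := by linarith
    -- Orthogonality eliminates `v 0`, and Lagrange's identity in the spatial plane leaves a square
    -- plus the positive term `-1/c · (v₁² + v₂²)`.
    have hsq : p 0 ^ 2 * (v 1 ^ 2 + v 2 ^ 2 - v 0 ^ 2)
        = (p 1 * v 2 - p 2 * v 1) ^ 2 - 1 / c * (v 1 ^ 2 + v 2 ^ 2) := by
      linear_combination (-p 0 * v 0 - (p 1 * v 1 + p 2 * v 2)) * key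
        - (v 1 ^ 2 + v 2 ^ 2) * hp1
    have hvv : 0 < v 1 ^ 2 + v 2 ^ 2 := by
      by_cases h1 : v 1 = 0
      · by_cases h2 : v 2 = 0
        · have : v 0 = 0 := by
            rw [h1, h2] at key
            simpa [hp0.ne'] using key
          simp_all
        · positivity
      · positivity
    have : 0 < p 0 ^ 2 * (v 1 ^ 2 + v 2 ^ 2 - v 0 ^ 2) := by
      rw [hsq]; nlinarith [sq_nonneg (p 1 * v 2 - p 2 * v 1)]
    have := (pos_iff_pos_of_mul_pos this).mp (by positivity)
    linarith
  · simp only [form, h, if_true] at *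
    rcases hne with h | h | h <;> nlinarith [sq_nonneg (v 0), sq_nonneg (v 1), sq_nonneg (v 2),
      sq_pos_of_ne_zero h]

/-- Of two timelike vectors with negative scalar product, both are future-directed if one is. -/
theorem zero_lt_of_form_neg {c : ℝ} (hc : c < 0) {x y : V} (hx : x ∈ spaceForm c)
    (hy : form c y y < 0) (hxy : form c x y < 0) : 0 < y 0 := by
  obtain ⟨hx1, hx2⟩ := hx
  have hx0 := hx2 hc
  have hcinv : 1 / c < 0 := one_div_neg.mpr hc
  simp only [form, not_lt.mpr hc.le, if_false] at *
  -- If `y 0 ≤ 0`, the spatial product would exceed `|x 0 * y 0|` in absolute value, against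
  -- Cauchy–Schwarz, since the spatial parts of timelike vectors are shorter than their time
  -- components.
  by_contra! h
  have h1 : 0 ≤ -(x 0 * y 0) := by nlinarith
  have h2 : -(x 0 * y 0) < -(x 1 * y 1 + x 2 * y 2) := by linarith
  have h3 : (x 0 * y 0) ^ 2 < (x 1 * y 1 + x 2 * y 2) ^ 2 := by nlinarith
  have h4 : (x 1 * y 1 + x 2 * y 2) ^ 2 ≤ (x 1 ^ 2 + x 2 ^ 2) * (y 1 ^ 2 + y 2 ^ 2) := by
    nlinarith [sq_nonneg (x 1 * y 2 - x 2 * y 1)]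
  have h5 : (x 1 ^ 2 + x 2 ^ 2) * (y 1 ^ 2 + y 2 ^ 2) ≤ x 0 ^ 2 * y 0 ^ 2 := by
    apply mul_le_mul <;> nlinarith [sq_nonneg (y 1), sq_nonneg (y 2)]
  nlinarith

/-- Reverse Cauchy–Schwarz: on the upper sheet the positive time component dominates the spatial
part. With `zero_lt_of_form_neg` it shows that isometries do not exchange sheets. -/
theorem form_neg_of_mem {c : ℝ} (hc : c < 0) {x y : V} (hx : x ∈ spaceForm c)
    (hy : y ∈ spaceForm c) : form c x y < 0 := by
  obtain ⟨hx1, hx2⟩ := hx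
  obtain ⟨hy1, hy2⟩ := hy
  have hx0 := hx2 hc
  have hy0 := hy2 hc
  have hcinv : 1 / c < 0 := one_div_neg.mpr hc
  simp only [form, not_lt.mpr hc.le, if_false] at *
  by_contra! h
  have h2 : x 0 * y 0 ≤ x 1 * y 1 + x 2 * y 2 := by linarith
  have h3 : (x 0 * y 0) ^ 2 ≤ (x 1 * y 1 + x 2 * y 2) ^ 2 := by
    apply pow_le_pow_left₀ (by positivity) h2
  have h4 : (x 1 * y 1 + x 2 * y 2) ^ 2 ≤ (x 1 ^ 2 + x 2 ^ 2) * (y 1 ^ 2 + y 2 ^ 2) := by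
    nlinarith [sq_nonneg (x 1 * y 2 - x 2 * y 1)]
  have h5 : (x 1 ^ 2 + x 2 ^ 2) * (y 1 ^ 2 + y 2 ^ 2) < x 0 ^ 2 * y 0 ^ 2 := by
    apply mul_lt_mul'' <;> first | positivity | nlinarith
  nlinarith

/-! ### Linear isometries -/

/-- A linear isometry that maps one point of the space form into it maps all of it into itself. -/
theorem mapsTo_spaceForm {c : ℝ} {L : V → V} (hL : ∀ x y, form c (L x) (L y) = form c x y)
    {q : V} (hq : q ∈ spaceForm c) (hLq : L q ∈ spaceForm c) :
    Set.MapsTo L (spaceForm c) (spaceForm c) := by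
  intro x hx
  have h1 : form c (L x) (L x) = 1 / c := (hL x x).trans hx.1
  refine ⟨h1, fun hc => zero_lt_of_form_neg hc hLq ?_ ?_⟩
  · rw [h1]; exact one_div_neg.mpr hc
  · rw [hL]; exact form_neg_of_mem hc hq hx

theorem bijOn_spaceForm {c : ℝ} {L : V ≃L[ℝ] V}
    (hL : ∀ x y, form c (L x) (L y) = form c x y)
    {q : V} (hq : q ∈ spaceForm c) (hLq : L q ∈ spaceForm c) :
    Set.BijOn L (spaceForm c) (spaceForm c) := by
  refine ⟨mapsTo_spaceForm hL hq hLq, L.injective.injOn, fun y hy => ⟨L.symm y, ?_, by simp⟩⟩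
  refine mapsTo_spaceForm (L := L.symm) (fun x y => ?_) hLq (by simpa using hq) hy
  rw [← hL]; simp

/-- A linear isometry of the second factor induces an isometry of the product. -/
theorem isIsometry_prodMap {c₁ c₂ : ℝ} {L : V ≃L[ℝ] V}
    (hL : ∀ x y, form c₂ (L x) (L y) = form c₂ x y)
    {q : V} (hq : q ∈ spaceForm c₂) (hLq : L q ∈ spaceForm c₂) :
    IsIsometry c₁ c₂ (fun x : A => (x.1, L x.2)) := by
  have e : (fun x : A => (x.1, L x.2))
      = ((ContinuousLinearMap.id ℝ V).prodMap (L : V →L[ℝ] V) : A →L[ℝ] A) := by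
    ext x <;> rfl
  refine ⟨?_, ?_, ?_⟩
  · rw [e]; exact ContinuousLinearMap.contDiff _
  · obtain ⟨h1, h2, h3⟩ := bijOn_spaceForm hL hq hLq
    refine ⟨fun x hx => ⟨hx.1, h1 hx.2⟩, fun x _ y _ h => ?_, fun y hy => ?_⟩
    · obtain ⟨ha, hb⟩ := Prod.ext_iff.mp h
      exact Prod.ext ha (L.injective hb)
    · obtain ⟨z, hz, hzy⟩ := h3 hy.2
      exact ⟨(y.1, z), ⟨hy.1, hz⟩, Prod.ext rfl hzy⟩
  · intro p _ X _ Y _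
    rw [e, ContinuousLinearMap.fderiv]
    simp [metric, hL]

/-! ### Cross products for both signatures -/

/-- The cross product of `ℝ³`, Euclidean for `ε = 1` and Lorentzian for `ε = -1`. -/
def cross (ε : ℝ) (x y : V) : V :=
  ![ε * (x 1 * y 2 - x 2 * y 1), x 2 * y 0 - x 0 * y 2, x 0 * y 1 - x 1 * y 0]

theorem euclCross_eq : euclCross = cross 1 := by
  funext x y
  simp [euclCross, cross, crossProduct]

theorem lorentzCross_eq : lorentzCross = cross (-1) := by
  funext x y
  simp [lorentzCross, cross]

theorem cross_smul_smul (ε s : ℝ) (x y : V) : cross ε (s • x) (s • y) = s ^ 2 • cross ε x y := by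
  ext i; fin_cases i <;> simp [cross] <;> ring

theorem cross_combination (ε a b a' b' : ℝ) (x y : V) :
    cross ε (a • x + b • y) (a' • x + b' • y) = (a * b' - b * a') • cross ε x y := by
  ext i; fin_cases i <;> simp [cross] <;> ring

theorem form_cross_left {c ε : ℝ} (hε : ε = if 0 < c then 1 else -1) (x y : V) :
    form c (cross ε x y) x = 0 := by
  simp only [form, ← hε, cross, Matrix.cons_val]
  have : ε * ε = 1 := by rw [hε]; split_ifs <;> norm_num
  linear_combination (x 1 * y 2 - x 2 * y 1) * x 0 * this

theorem form_cross_right {c ε : ℝ} (hε : ε = if 0 < c then 1 else -1) (x y : V) :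
    form c (cross ε x y) y = 0 := by
  simp only [form, ← hε, cross, Matrix.cons_val]
  have : ε * ε = 1 := by rw [hε]; split_ifs <;> norm_num
  linear_combination (x 1 * y 2 - x 2 * y 1) * y 0 * this

/-- Lagrange's identity; `ε` is the determinant of the scalar product. -/
theorem form_cross_cross {c ε : ℝ} (hε : ε = if 0 < c then 1 else -1) (x y : V) :
    form c (cross ε x y) (cross ε x y)
    = ε * (form c x x * form c y y - form c x y ^ 2) := by
  simp only [form, ← hε, cross, Matrix.cons_val]
  have h : ε = 1 ∨ ε = -1 := by rw [hε]; split_ifs <;> simp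
  rcases h with rfl | rfl <;> ring

/-! ### The product metric and the endomorphism `f` -/

theorem metric_comm (c₁ c₂ : ℝ) (X Y : A) : metric c₁ c₂ X Y = metric c₁ c₂ Y X := by
  simp only [metric, form_comm]

theorem metric_add_right (c₁ c₂ : ℝ) (X Y Z : A) :
    metric c₁ c₂ X (Y + Z) = metric c₁ c₂ X Y + metric c₁ c₂ X Z := by
  simp only [metric_comm c₁ c₂ X, metric_add_left]

theorem metric_smul_right (c₁ c₂ a : ℝ) (X Z : A) :
    metric c₁ c₂ X (a • Z) = a * metric c₁ c₂ X Z := by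
  simp only [metric_comm c₁ c₂ X, metric_smul_left]

theorem metric_sub_left (c₁ c₂ : ℝ) (X Y Z : A) :
    metric c₁ c₂ (X - Y) Z = metric c₁ c₂ X Z - metric c₁ c₂ Y Z := by
  rw [sub_eq_add_neg, ← neg_one_smul ℝ Y, metric_add_left, metric_smul_left]; ring

/-- Gram–Schmidt: the determinant times `|Da|²` is the squared length of the image of `|Da|² b -
⟨Da, Db⟩ a`, which is nonzero. -/
theorem gram_det_pos {c₁ c₂ : ℝ} {D : E2 →L[ℝ] A}
    (hD : ∀ X, X ≠ 0 → 0 < metric c₁ c₂ (D X) (D X)) : 0 < (gram c₁ c₂ D).det := by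
  set a := EuclideanSpace.single (0 : Fin 2) (1 : ℝ) with ha
  set b := EuclideanSpace.single (1 : Fin 2) (1 : ℝ) with hb
  have h0 : 0 < metric c₁ c₂ (D a) (D a) := hD a (by simp [ha])
  have hW : metric c₁ c₂ (D a) (D a) • b + (-metric c₁ c₂ (D a) (D b)) • a ≠ 0 := by
    intro h
    have := congrFun (congrArg WithLp.ofLp h) 1
    simp [ha, hb] at this
    exact h0.ne' this
  have h1 := hD _ hW
  simp only [map_add, map_smul, metric_add_left, metric_smul_left, metric_add_right,
    metric_smul_right, metric_comm c₁ c₂ (D b) (D a)] at h1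
  have h2 : (gram c₁ c₂ D).det = metric c₁ c₂ (D a) (D a) * metric c₁ c₂ (D b) (D b)
      - metric c₁ c₂ (D a) (D b) * metric c₁ c₂ (D a) (D b) := by
    rw [Matrix.det_fin_two]
    simp only [gram, Matrix.of_apply, ← ha, ← hb, metric_comm c₁ c₂ (D b) (D a)]
  rw [h2]
  refine (pos_iff_pos_of_mul_pos (a := metric c₁ c₂ (D a) (D a)) ?_).mp h0
  linarith

/-- A symmetric endomorphism with a single eigenvalue is a multiple of the identity; this is that
statement for `f`, in terms of the product structure. -/
theorem metric_productStructure {c₁ c₂ l : ℝ} {D : E2 →L[ℝ] A}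
    (hD : ∀ X, X ≠ 0 → 0 < metric c₁ c₂ (D X) (D X))
    (hl : eigenvaluesF c₁ c₂ D = {l, l}) (X Y : E2) :
    metric c₁ c₂ (productStructure (D X)) (D Y) = l * metric c₁ c₂ (D X) (D Y) := by
  set T := tangentEndo c₁ c₂ D with hT
  have hTg : ∀ X Y, metric c₁ c₂ (D (T X)) (D Y) = metric c₁ c₂ (productStructure (D X)) (D Y) := by
    intro X Y
    have := metric_sub_tangentialPart c₁ c₂ D (gram_det_pos hD).ne' (productStructure (D X)) Y
    rw [metric_sub_left] at this
    exact (sub_eq_zero.mp this).symm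
  have hsymm : ∀ X Y, metric c₁ c₂ (D (T X)) (D Y) = metric c₁ c₂ (D X) (D (T Y)) := by
    intro X Y
    rw [metric_comm c₁ c₂ (D X), hTg, hTg]
    simp only [metric, productStructure, form, LinearMap.prodMap_apply, LinearMap.id_apply,
      LinearMap.neg_apply, Pi.neg_apply]
    ring
  have hcp : T.charpoly = (Polynomial.X - Polynomial.C l) ^ 2 := by
    have hr : T.charpoly.roots = {l, l} := hl
    have h := Polynomial.prod_multiset_X_sub_C_of_monic_of_roots_card_eq T.charpoly_monic
      (by rw [hr, LinearMap.charpoly_natDegree]; simp)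
    rw [hr] at h
    rw [← h]
    simp [sq]
  have hsq : ∀ X, T (T X) = (2 * l) • T X - (l ^ 2) • X := by
    intro X
    have h := congrArg (fun S => S X) T.aeval_self_charpoly
    simp only [hcp, map_mul, map_sub, Polynomial.aeval_X, Polynomial.aeval_C, sq,
      Module.End.mul_apply, LinearMap.sub_apply, Module.algebraMap_end_apply, LinearMap.zero_apply] at h
    rw [map_smul] at h
    have h2 : T (T X) = (2 * l) • T X - (l ^ 2) • X
        + (T (T X) - l • T X - (l • T X - l • l • X)) := by
      module
    rw [h2, h, add_zero]
  -- By symmetry and Cayley–Hamilton, `|(T - l)X|² = ⟨X, (T - l)²X⟩ = 0`; definiteness concludes.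
  have hN : T X - l • X = 0 := by
    by_contra hne
    have hpos := hD _ hne
    have e : metric c₁ c₂ (D (T X - l • X)) (D (T X - l • X)) = 0 := by
      have e1 := hsymm X (T X)
      have e2 := hsymm X X
      rw [hsq] at e1
      simp only [sub_eq_add_neg, ← neg_smul, map_add, map_smul, metric_add_left, metric_smul_left,
        metric_add_right, metric_smul_right] at *
      linear_combination e1 - l * e2
    exact hpos.ne' e
  rw [← hTg, sub_eq_zero.mp hN, map_smul, metric_smul_left]

/-- If `f` is the multiple `(c₂ - c₁) / (c₁ + c₂)` of the identity, both projections of the tangent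
plane are homothetic. -/
theorem form_fst_eq_form_snd {c₁ c₂ : ℝ} (hc : 0 < c₁ * c₂) {D : E2 →L[ℝ] A}
    (hD : ∀ X, X ≠ 0 → 0 < metric c₁ c₂ (D X) (D X))
    (hl : eigenvaluesF c₁ c₂ D = {(c₂ - c₁) / (c₁ + c₂), (c₂ - c₁) / (c₁ + c₂)}) (X Y : E2) :
    c₁ * form c₁ (D X).1 (D Y).1 = c₂ * form c₂ (D X).2 (D Y).2 := by
  have h := metric_productStructure hD hl X Y
  have hs : c₁ + c₂ ≠ 0 := by
    intro h0
    have : c₂ = -c₁ := by linarith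
    rw [this] at hc
    nlinarith [sq_nonneg c₁]
  have e : metric c₁ c₂ (productStructure (D X)) (D Y)
      = form c₁ (D X).1 (D Y).1 - form c₂ (D X).2 (D Y).2 := by
    simp only [metric, productStructure, form, LinearMap.prodMap_apply, LinearMap.id_apply,
      LinearMap.neg_apply, Pi.neg_apply]
    ring
  -- With `a`, `b` the contributions of the two factors, `a - b = l (a + b)` clears to `c₁ a = c₂
  -- b`.
  rw [e, metric] at h
  field_simp at h
  linarith

/-! ### Moving frames and rigidity -/

/-- The derivative of `z ↦ form c (f z) (g z)`. -/
theorem hasFDerivAt_form {E : Type*} [NormedAddCommGroup E] [NormedSpace ℝ E] (c : ℝ) {f g : E → V}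
    {f' g' : E →L[ℝ] V} {y : E} (hf : HasFDerivAt f f' y) (hg : HasFDerivAt g g' y) :
    HasFDerivAt (fun z => form c (f z) (g z))
      ((formL c).precompR E (f y) g' + (formL c).precompL E f' (g y)) y := by
  simp only [← formL_apply]
  exact (formL c).hasFDerivAt_of_bilinear hf hg

/-- If `form c (f z) (g z)` is locally constant, its Leibniz derivative vanishes. -/
theorem form_add_form_eq_zero {E : Type*} [NormedAddCommGroup E] [NormedSpace ℝ E] {c : ℝ}
    {f g : E → V} {f' g' : E →L[ℝ] V} {y : E} (hf : HasFDerivAt f f' y) (hg : HasFDerivAt g g' y)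
    {a : ℝ} (h : ∀ᶠ z in nhds y, form c (f z) (g z) = a) (X : E) :
    form c (f y) (g' X) + form c (f' X) (g y) = 0 := by
  have h1 := hasFDerivAt_form c hf hg
  have h2 : HasFDerivAt (fun z => form c (f z) (g z)) (0 : E →L[ℝ] ℝ) y :=
    (hasFDerivAt_const a y).congr_of_eventuallyEq h
  have := congrArg (fun S => S X) (h1.unique h2)
  simpa [formL_apply] using this

/-- The metric induced by an immersion is positive definite. -/
theorem metric_self_pos {c₁ c₂ : ℝ} (hc₁ : c₁ ≠ 0) (hc₂ : c₂ ≠ 0) {p X : A}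
    (hp : p ∈ prodForm c₁ c₂) (hX : X ∈ prodTangent c₁ c₂ p) (h0 : X ≠ 0) :
    0 < metric c₁ c₂ X X := by
  have nn : ∀ {c : ℝ} {q v : V}, c ≠ 0 → q ∈ spaceForm c → form c q v = 0 → 0 ≤ form c v v := by
    intro c q v hc hq hv
    by_cases h : v = 0
    · simp [h, form_zero_left]
    · exact (form_self_pos hc hq hv h).le
  by_cases h : X.1 = 0
  · have h2 : X.2 ≠ 0 := fun h2 => h0 (Prod.ext h h2)
    exact add_pos_of_nonneg_of_pos (nn hc₁ hp.1 hX.1) (form_self_pos hc₂ hp.2 hX.2 h2)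
  · exact add_pos_of_pos_of_nonneg (form_self_pos hc₁ hp.1 hX.1 h) (nn hc₂ hp.2 hX.2)

/-- The linear map `ℝ × ℝ² → ℝ³` built from a position vector and a differential. -/
noncomputable def frame (x : V) (D : E2 →L[ℝ] V) : ℝ × E2 →L[ℝ] V :=
  ContinuousLinearMap.smulRightL ℝ (ℝ × E2) V (ContinuousLinearMap.fst ℝ ℝ E2) x
    + (ContinuousLinearMap.compL ℝ (ℝ × E2) E2 V).flip (ContinuousLinearMap.snd ℝ ℝ E2) D

theorem frame_apply (x : V) (D : E2 →L[ℝ] V) (s : ℝ × E2) : frame x D s = s.1 • x + D s.2 := by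
  simp [frame]

theorem hasFDerivAt_frame {x : E2 → V} {D : E2 → E2 →L[ℝ] V} {x' : E2 →L[ℝ] V}
    {D' : E2 →L[ℝ] E2 →L[ℝ] V} {y : E2} (hx : HasFDerivAt x x' y) (hD : HasFDerivAt D D' y) :
    ∃ F' : E2 →L[ℝ] (ℝ × E2 →L[ℝ] V), HasFDerivAt (fun z => frame (x z) (D z)) F' y ∧
      ∀ X s, F' X s = s.1 • x' X + D' X s.2 := by
  refine ⟨_, ((ContinuousLinearMap.hasFDerivAt _).comp y hx).add
    ((ContinuousLinearMap.hasFDerivAt _).comp y hD), fun X s => ?_⟩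
  simp

/-- The frame of an immersion whose image is tangent to a space form is invertible. -/
theorem exists_equiv_frame {c : ℝ} (hc : c ≠ 0) {x : V} {D : E2 →L[ℝ] V} (hx : x ∈ spaceForm c)
    (hT : ∀ Y, form c x (D Y) = 0) (hD : Function.Injective D) :
    ∃ e : (ℝ × E2) ≃L[ℝ] V, (e : ℝ × E2 →L[ℝ] V) = frame x D := by
  have hinj : Function.Injective (frame x D) := by
    rw [injective_iff_map_eq_zero]
    intro s hs
    rw [frame_apply] at hs
    have h1 : form c x (s.1 • x + D s.2) = 0 := by rw [hs, form_zero_right]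
    rw [form_add_right, form_smul_right, hT, hx.1] at h1
    have h2 : s.1 = 0 := by simpa [hc] using h1
    rw [h2, zero_smul, zero_add] at hs
    exact Prod.ext h2 ((injective_iff_map_eq_zero D).mp hD _ hs)
  have hfin : Module.finrank ℝ (ℝ × E2) = Module.finrank ℝ V := by simp
  refine ⟨(LinearMap.linearEquivOfInjective (frame x D : ℝ × E2 →ₗ[ℝ] V) hinj
    hfin).toContinuousLinearEquiv, ?_⟩
  ext s <;> rfl

/-- Frames are pairings of the position vector and the induced metric. -/
theorem form_frame {c : ℝ} (hc : c ≠ 0) {x : V} {D : E2 →L[ℝ] V} (hx : x ∈ spaceForm c)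
    (hT : ∀ Y, form c x (D Y) = 0) (s t : ℝ × E2) :
    c * form c (frame x D s) (frame x D t) = s.1 * t.1 + c * form c (D s.2) (D t.2) := by
  simp only [frame_apply, form_add_left, form_add_right, form_smul_left, form_smul_right, hx.1, hT,
    form_comm c (D s.2) x]
  field_simp
  ring

/-- Two moving frames with the same structure equations differ by a constant linear map. -/
theorem frames_congruent {F₁ F₂ : E2 → ℝ × E2 →L[ℝ] V} {U : Set E2} (hU : IsOpen U)
    (hconv : Convex ℝ U)
    (h₁ : ∀ y ∈ U, ∃ e : (ℝ × E2) ≃L[ℝ] V, (e : ℝ × E2 →L[ℝ] V) = F₁ y)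
    (hF : ∀ y ∈ U, ∃ F₁' F₂' : E2 →L[ℝ] (ℝ × E2 →L[ℝ] V),
      HasFDerivAt F₁ F₁' y ∧ HasFDerivAt F₂ F₂' y ∧
      ∀ X s, ∃ t, F₁' X s = F₁ y t ∧ F₂' X s = F₂ y t) {y₀ y : E2} (hy₀ : y₀ ∈ U) (hy : y ∈ U) :
    F₂ y ∘L (F₁ y).inverse = F₂ y₀ ∘L (F₁ y₀).inverse := by
  -- Put `G = F₂ F₁⁻¹` and differentiate `G F₁ = F₂`. The structure equations give `G F₁' = F₂'`,
  -- whence `G' F₁ = 0`, and `F₁` is invertible.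
  have key : ∀ z ∈ U, HasFDerivAt (fun y => F₂ y ∘L (F₁ y).inverse)
      (0 : E2 →L[ℝ] V →L[ℝ] V) z := by
    intro z hz
    obtain ⟨F₁', F₂', hF₁, hF₂, hs⟩ := hF z hz
    obtain ⟨e, he⟩ := h₁ z hz
    have hinv : DifferentiableAt ℝ (fun y => (F₁ y).inverse) z := by
      have h := (contDiffAt_map_inverse (𝕜 := ℝ) (n := 1) e).differentiableAt one_ne_zero
      rw [he] at h
      exact h.comp z hF₁.differentiableAt
    have hQ : DifferentiableAt ℝ (fun y => F₂ y ∘L (F₁ y).inverse) z :=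
      hF₂.differentiableAt.clm_comp hinv
    have hprod := hQ.hasFDerivAt.clm_comp hF₁
    have heq : (fun y => (F₂ y ∘L (F₁ y).inverse) ∘L F₁ y) =ᶠ[nhds z] F₂ := by
      filter_upwards [hU.mem_nhds hz] with w hw
      obtain ⟨e', he'⟩ := h₁ w hw
      rw [← he', ContinuousLinearMap.inverse_equiv]
      ext <;> simp
    have hu := (hF₂.congr_of_eventuallyEq heq).unique hprod
    convert! hQ.hasFDerivAt
    symm
    ext1 X
    ext1 v
    obtain ⟨s, rfl⟩ := e.surjective v
    have := congrArg (fun S => S X s) hu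
    obtain ⟨t, ht₁, ht₂⟩ := hs X s
    simp only [add_apply, ContinuousLinearMap.coe_comp, Function.comp_apply,
      ContinuousLinearMap.compL_apply, ContinuousLinearMap.flip_apply, ht₁, ht₂, ← he,
      ContinuousLinearMap.inverse_equiv, ContinuousLinearEquiv.coe_coe,
      ContinuousLinearEquiv.symm_apply_apply] at this
    simpa using this
  refine hconv.is_const_of_fderivWithin_eq_zero (𝕜 := ℝ)
    (fun z hz => (key z hz).differentiableAt.differentiableWithinAt) (fun z hz => ?_) hy hy₀
  exact (key z hz).hasFDerivWithinAt.fderivWithin (hU.uniqueDiffWithinAt hz)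

/-- Gauss formula for the factor `P` of a totally geodesic surface. -/
theorem factor_fderiv_fderiv {c : ℝ} {P : A →L[ℝ] V} {Φ : E2 → A} {y : E2}
    (hΦ : ∀ᶠ z in nhds y, DifferentiableAt ℝ Φ z) (hΦ' : DifferentiableAt ℝ (fderiv ℝ Φ) y)
    (hmem : ∀ᶠ z in nhds y, P (Φ z) ∈ spaceForm c) {X Y T : E2}
    (hσ : tangentProj c (P (Φ y)) (P (fderiv ℝ (fun z => fderiv ℝ Φ z Y) y X))
      = P (fderiv ℝ Φ y T)) :
    P (fderiv ℝ (fderiv ℝ Φ) y X Y) = P (fderiv ℝ Φ y T)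
      - (c * form c (P (fderiv ℝ Φ y X)) (P (fderiv ℝ Φ y Y))) • P (Φ y) := by
  have hY : HasFDerivAt (fun z => fderiv ℝ Φ z Y) ((fderiv ℝ (fderiv ℝ Φ) y).flip Y) y := by
    simpa using hΦ'.hasFDerivAt.clm_apply (hasFDerivAt_const Y y)
  have hPΦ : ∀ᶠ z in nhds y, HasFDerivAt (fun z => P (Φ z)) (P ∘L fderiv ℝ Φ z) z := by
    filter_upwards [hΦ] with z hz using P.hasFDerivAt.comp z hz.hasFDerivAt
  have hT : ∀ᶠ z in nhds y, form c (P (Φ z)) (P (fderiv ℝ Φ z Y)) = 0 := by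
    filter_upwards [hPΦ, hmem.eventually_nhds] with z hz hz'
    have := form_add_form_eq_zero hz hz (hz'.mono fun w hw => hw.1) Y
    rw [form_comm c _ (P (Φ z))] at this
    simpa using this
  -- Differentiating the orthogonality of position and tangent vectors gives the normal part of the
  -- second derivative: `⟨PΦ, D²(PΦ)(X, Y)⟩ = -⟨P dΦ X, P dΦ Y⟩`.
  have h2 := form_add_form_eq_zero hPΦ.self_of_nhds (P.hasFDerivAt.comp y hY) hT X
  simp only [ContinuousLinearMap.coe_comp, Function.comp_apply,
    ContinuousLinearMap.flip_apply] at h2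
  rw [hY.fderiv, ContinuousLinearMap.flip_apply, tangentProj, sub_eq_iff_eq_add] at hσ
  rw [hσ, eq_neg_of_add_eq_zero_left h2]
  module

/-- A totally geodesic surface whose two projections are homothetic is the graph of a linear
homothety. -/
theorem exists_homothety {c₁ c₂ : ℝ} (hc₁ : c₁ ≠ 0) (hc₂ : c₂ ≠ 0) {Φ : E2 → A} {U : Set E2}
    (hU : IsOpen U) (hconv : Convex ℝ U) (hne : U.Nonempty) (hΦ : ContDiffOn ℝ ∞ Φ U)
    (hmem : ∀ y ∈ U, Φ y ∈ prodForm c₁ c₂)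
    (himm : ∀ y ∈ U, Function.Injective (fderiv ℝ Φ y))
    (hconf : ∀ y ∈ U, ∀ X Y, c₁ * form c₁ (fderiv ℝ Φ y X).1 (fderiv ℝ Φ y Y).1
      = c₂ * form c₂ (fderiv ℝ Φ y X).2 (fderiv ℝ Φ y Y).2)
    (hσ : ∀ y ∈ U, ∀ X Y, secondFundamentalForm c₁ c₂ Φ y X Y = 0) :
    ∃ Q : V ≃L[ℝ] V, (∀ y ∈ U, (Φ y).2 = Q (Φ y).1) ∧
      ∀ x y, c₂ * form c₂ (Q x) (Q y) = c₁ * form c₁ x y := by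
  set P₁ := ContinuousLinearMap.fst ℝ V V with hP₁
  set P₂ := ContinuousLinearMap.snd ℝ V V with hP₂
  have hd : ∀ y ∈ U, DifferentiableAt ℝ Φ y := fun y hy =>
    (hΦ.contDiffAt (hU.mem_nhds hy)).differentiableAt (by simp)
  have hd2 : ∀ y ∈ U, DifferentiableAt ℝ (fderiv ℝ Φ) y := fun y hy =>
    ((hΦ.contDiffAt (hU.mem_nhds hy)).fderiv_right (m := 1)
      (by rw [one_add_one_eq_two]; exact WithTop.coe_le_coe.mpr le_top)).differentiableAt one_ne_zero
  have htan : ∀ y ∈ U, ∀ Y, form c₁ (P₁ (Φ y)) (P₁ (fderiv ℝ Φ y Y)) = 0 ∧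
      form c₂ (P₂ (Φ y)) (P₂ (fderiv ℝ Φ y Y)) = 0 := by
    intro y hy Y
    have h1 := P₁.hasFDerivAt.comp y (hd y hy).hasFDerivAt
    have h2 := P₂.hasFDerivAt.comp y (hd y hy).hasFDerivAt
    have e1 := form_add_form_eq_zero (c := c₁) h1 h1
      (by filter_upwards [hU.mem_nhds hy] with z hz using (hmem z hz).1.1) Y
    have e2 := form_add_form_eq_zero (c := c₂) h2 h2
      (by filter_upwards [hU.mem_nhds hy] with z hz using (hmem z hz).2.1) Y
    rw [form_comm _ _ ((P₁ ∘ Φ) y)] at e1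
    rw [form_comm _ _ ((P₂ ∘ Φ) y)] at e2
    exact ⟨by simpa using e1, by simpa using e2⟩
  -- Homothetic projections have the same kernel, so injectivity of `dΦ` passes to each of them.
  have hker : ∀ y ∈ U, ∀ Y, P₁ (fderiv ℝ Φ y Y) = 0 ↔ P₂ (fderiv ℝ Φ y Y) = 0 := by
    intro y hy Y
    have h := hconf y hy Y Y
    constructor
    · intro h0
      by_contra hne
      have := form_self_pos hc₂ (hmem y hy).2 (htan y hy Y).2 hne
      rw [show (fderiv ℝ Φ y Y).1 = 0 from h0, form_zero_left, mul_zero, eq_comm,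
        mul_eq_zero] at h
      exact this.ne' (h.resolve_left hc₂)
    · intro h0
      by_contra hne
      have := form_self_pos hc₁ (hmem y hy).1 (htan y hy Y).1 hne
      rw [show (fderiv ℝ Φ y Y).2 = 0 from h0, form_zero_left, mul_zero, mul_eq_zero] at h
      exact this.ne' (h.resolve_left hc₁)
  have hinj₁ : ∀ y ∈ U, Function.Injective (P₁ ∘L fderiv ℝ Φ y) := by
    intro y hy
    rw [injective_iff_map_eq_zero]
    intro Y h
    exact (injective_iff_map_eq_zero _).mp (himm y hy) Y (Prod.ext h ((hker y hy Y).mp h))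
  have hinj₂ : ∀ y ∈ U, Function.Injective (P₂ ∘L fderiv ℝ Φ y) := by
    intro y hy
    rw [injective_iff_map_eq_zero]
    intro Y h
    exact (injective_iff_map_eq_zero _).mp (himm y hy) Y (Prod.ext ((hker y hy Y).mpr h) h)
  set F₁ : E2 → ℝ × E2 →L[ℝ] V := fun y => frame (P₁ (Φ y)) (P₁ ∘L fderiv ℝ Φ y) with hF₁
  set F₂ : E2 → ℝ × E2 →L[ℝ] V := fun y => frame (P₂ (Φ y)) (P₂ ∘L fderiv ℝ Φ y) with hF₂
  have he₁ : ∀ y ∈ U, ∃ e : (ℝ × E2) ≃L[ℝ] V, (e : ℝ × E2 →L[ℝ] V) = F₁ y := fun y hy =>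
    exists_equiv_frame hc₁ (hmem y hy).1 (fun Y => (htan y hy Y).1) (hinj₁ y hy)
  have he₂ : ∀ y ∈ U, ∃ e : (ℝ × E2) ≃L[ℝ] V, (e : ℝ × E2 →L[ℝ] V) = F₂ y := fun y hy =>
    exists_equiv_frame hc₂ (hmem y hy).2 (fun Y => (htan y hy Y).2) (hinj₂ y hy)
  have hstr : ∀ y ∈ U, ∃ F₁' F₂' : E2 →L[ℝ] (ℝ × E2 →L[ℝ] V),
      HasFDerivAt F₁ F₁' y ∧ HasFDerivAt F₂ F₂' y ∧
      ∀ X s, ∃ t, F₁' X s = F₁ y t ∧ F₂' X s = F₂ y t := by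
    intro y hy
    have hcomp : ∀ P : A →L[ℝ] V, HasFDerivAt (fun z => P ∘L fderiv ℝ Φ z)
        ((ContinuousLinearMap.compL ℝ E2 A V P) ∘L fderiv ℝ (fderiv ℝ Φ) y) y := fun P =>
      ((ContinuousLinearMap.compL ℝ E2 A V P).hasFDerivAt).comp y (hd2 y hy).hasFDerivAt
    obtain ⟨F₁', h₁, h₁'⟩ := hasFDerivAt_frame
      (P₁.hasFDerivAt.comp y (hd y hy).hasFDerivAt) (hcomp P₁)
    obtain ⟨F₂', h₂, h₂'⟩ := hasFDerivAt_frame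
      (P₂.hasFDerivAt.comp y (hd y hy).hasFDerivAt) (hcomp P₂)
    refine ⟨F₁', F₂', h₁, h₂, fun X s => ?_⟩
    have hs := sub_eq_zero.mp (hσ y hy X s.2)
    set T := tangentialPart c₁ c₂ (fderiv ℝ Φ y) (covDeriv c₁ c₂ Φ y X s.2)
    have hev : ∀ᶠ z in nhds y, DifferentiableAt ℝ Φ z := by
      filter_upwards [hU.mem_nhds hy] with z hz using hd z hz
    have g₁ := factor_fderiv_fderiv (c := c₁) (P := P₁) (T := T) hev (hd2 y hy)
      (by filter_upwards [hU.mem_nhds hy] with z hz using (hmem z hz).1) (congrArg Prod.fst hs)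
    have g₂ := factor_fderiv_fderiv (c := c₂) (P := P₂) (T := T) hev (hd2 y hy)
      (by filter_upwards [hU.mem_nhds hy] with z hz using (hmem z hz).2) (congrArg Prod.snd hs)
    -- The derivative of the frame vector `s` is `s.1 • dx(X) + D²x(X, s.2)`; Gauss's formula
    -- expands it in the frame. These coefficients serve both factors because `T` is common and
    -- `hconf` identifies the normal terms.
    refine ⟨(-(c₁ * form c₁ (fderiv ℝ Φ y X).1 (fderiv ℝ Φ y s.2).1), s.1 • X + T), ?_, ?_⟩
    · rw [h₁']
      simp only [hF₁, frame_apply, ContinuousLinearMap.coe_comp, Function.comp_apply,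
        ContinuousLinearMap.compL_apply, g₁, map_add, map_smul]
      simp only [hP₁, ContinuousLinearMap.coe_fst']
      module
    · rw [h₂', hconf y hy]
      simp only [hF₂, frame_apply, ContinuousLinearMap.coe_comp, Function.comp_apply,
        ContinuousLinearMap.compL_apply, g₂, map_add, map_smul]
      simp only [hP₂, ContinuousLinearMap.coe_snd']
      module
  obtain ⟨y₀, hy₀⟩ := hne
  obtain ⟨e₁, he₁₀⟩ := he₁ y₀ hy₀
  obtain ⟨e₂, he₂₀⟩ := he₂ y₀ hy₀
  have hQ : ∀ y ∈ U, ∀ s, F₂ y s = e₂ (e₁.symm (F₁ y s)) := by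
    intro y hy s
    have h := frames_congruent hU hconv he₁ hstr hy₀ hy
    obtain ⟨e, he⟩ := he₁ y hy
    rw [← he, ← he₁₀, ← he₂₀, ContinuousLinearMap.inverse_equiv,
      ContinuousLinearMap.inverse_equiv] at h
    have := congrArg (fun S => S (e s)) h
    rw [← he]
    simpa using this
  refine ⟨e₁.symm.trans e₂, fun y hy => ?_, fun x z => ?_⟩
  -- The index `(1, 0)` selects the position vector of the frame.
  · have := hQ y hy (1, 0)
    simpa [hF₁, hF₂, frame_apply, hP₁, hP₂] using this
  · obtain ⟨s, rfl⟩ := e₁.surjective x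
    obtain ⟨t, rfl⟩ := e₁.surjective z
    have h₁ : ∀ s, e₁ s = F₁ y₀ s := fun s => by rw [← he₁₀]; rfl
    have h₂ : ∀ s, e₂ s = F₂ y₀ s := fun s => by rw [← he₂₀]; rfl
    simp only [ContinuousLinearEquiv.trans_apply, ContinuousLinearEquiv.symm_apply_apply]
    have f₁ := form_frame (D := P₁ ∘L fderiv ℝ Φ y₀) hc₁ (hmem y₀ hy₀).1
      (fun Y => (htan y₀ hy₀ Y).1) s t
    have f₂ := form_frame (D := P₂ ∘L fderiv ℝ Φ y₀) hc₂ (hmem y₀ hy₀).2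
      (fun Y => (htan y₀ hy₀ Y).2) s t
    rw [h₁, h₁, h₂, h₂]
    refine f₂.trans (Eq.trans ?_ f₁.symm)
    exact congrArg _ (hconf y₀ hy₀ s.2 t.2).symm

/-! ### Unified trigonometry and adapted frames -/

/-- `C`, `S`, `I` are the cosine, the sine and the inverse of the sine, circular if `ε = 1` and
hyperbolic if `ε = -1`. -/
structure IsTrig (ε : ℝ) (C S I : ℝ → ℝ) : Prop where
  contDiff_cos : ContDiff ℝ ∞ C
  contDiff_sin : ContDiff ℝ ∞ S
  hasDerivAt_cos : ∀ t, HasDerivAt C (-(ε * S t)) t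
  hasDerivAt_sin : ∀ t, HasDerivAt S (C t) t
  cos_sq_add : ∀ t, C t ^ 2 + ε * S t ^ 2 = 1
  cos_pos : ε < 0 → ∀ t, 0 < C t
  -- The condition means `|y| < 1` in the circular case and is automatic in the hyperbolic one.
  contDiffAt_inv : ∀ y, 0 < 1 - ε * y ^ 2 → ContDiffAt ℝ ∞ I y
  sin_inv : ∀ y, 0 < 1 - ε * y ^ 2 → S (I y) = y
  cos_inv : ∀ y, 0 < 1 - ε * y ^ 2 → C (I y) = Real.sqrt (1 - ε * y ^ 2)

theorem isTrig_circular : IsTrig 1 Real.cos Real.sin Real.arcsin where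
  contDiff_cos := Real.contDiff_cos
  contDiff_sin := Real.contDiff_sin
  hasDerivAt_cos t := by simpa using Real.hasDerivAt_cos t
  hasDerivAt_sin := Real.hasDerivAt_sin
  cos_sq_add t := by rw [one_mul]; exact Real.cos_sq_add_sin_sq t
  cos_pos h := by norm_num at h
  contDiffAt_inv y hy := Real.contDiffAt_arcsin (by rintro rfl; norm_num at hy)
    (by rintro rfl; norm_num at hy)
  sin_inv y hy := Real.sin_arcsin (by nlinarith) (by nlinarith)
  cos_inv y _ := by rw [one_mul, Real.cos_arcsin]

theorem isTrig_hyperbolic : IsTrig (-1) Real.cosh Real.sinh Real.arsinh where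
  contDiff_cos := Real.contDiff_cosh
  contDiff_sin := Real.contDiff_sinh
  hasDerivAt_cos t := by simpa using Real.hasDerivAt_cosh t
  hasDerivAt_sin := Real.hasDerivAt_sinh
  cos_sq_add t := by linarith [Real.cosh_sq_sub_sinh_sq t]
  cos_pos _ := Real.cosh_pos
  contDiffAt_inv _ _ := Real.contDiff_arsinh.contDiffAt
  sin_inv y _ := Real.sinh_arsinh y
  cos_inv y _ := by rw [Real.cosh_arsinh]; congr 1; ring

/-- An orthogonal frame `x, W, N` with `x` in the space form and `W`, `N` tangent to it, of the
same length as `x`. -/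
structure IsAdaptedFrame (c ε : ℝ) (x W N : V) : Prop where
  mem : x ∈ spaceForm c
  form_W : form c W W = ε / c
  form_N : form c N N = ε / c
  form_x_W : form c x W = 0
  form_x_N : form c x N = 0
  form_W_N : form c W N = 0

section

variable {c ε : ℝ} {x W N : V}

theorem IsAdaptedFrame.form_combination (h : IsAdaptedFrame c ε x W N) (hc : c ≠ 0)
    (a b n a' b' n' : ℝ) :
    c * form c (a • x + b • W + n • N) (a' • x + b' • W + n' • N)
      = a * a' + ε * (b * b' + n * n') := by
  have hx := h.mem.1
  simp only [form_add_left, form_add_right, form_smul_left, form_smul_right, hx, h.form_W, h.form_N,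
    h.form_x_W, h.form_x_N, h.form_W_N, form_comm c W x, form_comm c N x, form_comm c N W]
  field_simp
  ring

/-- Coordinates with respect to an adapted frame. -/
theorem IsAdaptedFrame.exists_eq (h : IsAdaptedFrame c ε x W N) (hc : c ≠ 0) (hε : ε * ε = 1)
    (z : V) : z = (c * form c z x) • x + (ε * c * form c z W) • W + (ε * c * form c z N) • N := by
  have hε0 : ε ≠ 0 := by rintro rfl; simp at hε
  let T : V →ₗ[ℝ] V :=
    { toFun := fun t => t 0 • x + t 1 • W + t 2 • N
      map_add' := fun s t => by simp only [Pi.add_apply]; module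
      map_smul' := fun a t => by simp only [Pi.smul_apply, smul_eq_mul, RingHom.id_apply]; module }
  have hT : ∀ t, T t = t 0 • x + t 1 • W + t 2 • N := fun _ => rfl
  -- Orthogonality gives independence, hence a basis by dimension. Coefficients are read off by
  -- pairing; `ε` appears in them because `c⟨W, W⟩ = c⟨N, N⟩ = ε = ε⁻¹`.
  have hinj : Function.Injective T := by
    rw [injective_iff_map_eq_zero]
    intro t ht
    have key : ∀ a b n, t 0 * a + ε * (t 1 * b + t 2 * n) = 0 := by
      intro a b n
      rw [← h.form_combination hc, ← hT, ht, form_zero_left, mul_zero]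
    ext i
    fin_cases i
    · simpa using key 1 0 0
    · simpa [hε0] using key 0 1 0
    · simpa [hε0] using key 0 0 1
  obtain ⟨t, rfl⟩ := LinearMap.surjective_of_injective hinj z
  rw [hT]
  have e0 : c * form c (t 0 • x + t 1 • W + t 2 • N) x = t 0 := by
    simpa using h.form_combination hc (t 0) (t 1) (t 2) 1 0 0
  have e1 : c * form c (t 0 • x + t 1 • W + t 2 • N) W = ε * t 1 := by
    simpa using h.form_combination hc (t 0) (t 1) (t 2) 0 1 0
  have e2 : c * form c (t 0 • x + t 1 • W + t 2 • N) N = ε * t 2 := by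
    simpa using h.form_combination hc (t 0) (t 1) (t 2) 0 0 1
  rw [mul_assoc ε, mul_assoc ε, e0, e1, e2, ← mul_assoc, ← mul_assoc, hε, one_mul, one_mul]

end

/-! ### Great circles and their hyperbolic analogues -/

/-- The geodesic through `x` in the direction `W`, with angular velocity `k`. -/
def greatCircle (C S : ℝ → ℝ) (k : ℝ) (x W : V) (t : ℝ) : V := C (k * t) • x + S (k * t) • W

section

variable {ε : ℝ} {C S I : ℝ → ℝ}

theorem smul_greatCircle (s k : ℝ) (x W : V) :
    s • greatCircle C S k x W = greatCircle C S k (s • x) (s • W) := by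
  funext t
  simp only [greatCircle, Pi.smul_apply]
  module

theorem IsTrig.hasDerivAt_greatCircle (h : IsTrig ε C S I) (k : ℝ) (x W : V) (t : ℝ) :
    HasDerivAt (greatCircle C S k x W)
      ((k * -(ε * S (k * t))) • x + (k * C (k * t)) • W) t := by
  have hk : HasDerivAt (fun t => k * t) k t := by simpa using (hasDerivAt_id t).const_mul k
  have h1 := ((h.hasDerivAt_cos (k * t)).comp t hk).smul_const x
  have h2 := ((h.hasDerivAt_sin (k * t)).comp t hk).smul_const W
  convert! h1.add h2 using 1
  rw [mul_comm k (-(ε * S (k * t))), mul_comm k (C (k * t))]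

theorem IsTrig.deriv_greatCircle (h : IsTrig ε C S I) (k : ℝ) (x W : V) :
    deriv (greatCircle C S k x W)
      = fun t => (k * -(ε * S (k * t))) • x + (k * C (k * t)) • W :=
  funext fun t => (h.hasDerivAt_greatCircle k x W t).deriv

theorem IsTrig.deriv_deriv_greatCircle (h : IsTrig ε C S I) (k : ℝ) (x W : V) (t : ℝ) :
    deriv (deriv (greatCircle C S k x W)) t = (-(ε * k ^ 2)) • greatCircle C S k x W t := by
  -- The derivative is `k` times a curve of the same kind, so the first-derivative formula can be
  -- applied again.
  have e : deriv (greatCircle C S k x W)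
      = fun t => k • greatCircle C S k W (-ε • x) t := by
    rw [h.deriv_greatCircle]
    funext t
    simp only [greatCircle]
    module
  rw [e]
  refine ((h.hasDerivAt_greatCircle k W (-ε • x) t).const_smul k).deriv.trans ?_
  rw [greatCircle]
  module

theorem IsTrig.contDiff_greatCircle (h : IsTrig ε C S I) (k : ℝ) (x W : V) :
    ContDiff ℝ ∞ (greatCircle C S k x W) := by
  have hk : ContDiff ℝ ∞ (fun t : ℝ => k * t) := contDiff_const.mul contDiff_id
  exact ((h.contDiff_cos.comp hk).smul contDiff_const).add
    ((h.contDiff_sin.comp hk).smul contDiff_const)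

/-- The acceleration is a multiple of the position vector, which the tangential projection kills.
For `c < 0` the curve stays on the sheet of `x` because its product with `x` is `C(kt) / c < 0`. -/
theorem IsTrig.isGeodesic_greatCircle (h : IsTrig ε C S I) {c : ℝ} (hc : c ≠ 0)
    (hε : ε = if 0 < c then 1 else -1) (k : ℝ) {x W : V} (hx : x ∈ spaceForm c)
    (hxW : form c x W = 0) (hW : form c W W = ε / c) :
    IsGeodesic c (greatCircle C S k x W) := by
  have hself : ∀ t, form c (greatCircle C S k x W t) (greatCircle C S k x W t) = 1 / c := by
    intro t
    simp only [greatCircle, form_add_left, form_add_right, form_smul_left, form_smul_right,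
      hx.1, hxW, form_comm c W x, hW]
    field_simp
    linear_combination h.cos_sq_add (k * t)
  refine ⟨h.contDiff_greatCircle k x W, fun t => ⟨hself t, fun hneg => ?_⟩, fun t => ?_⟩
  · have hε' : ε < 0 := by rw [hε, if_neg hneg.not_gt]; norm_num
    have hinv : 1 / c < 0 := one_div_neg.mpr hneg
    refine zero_lt_of_form_neg hneg hx ((hself t).trans_lt hinv) ?_
    simp only [greatCircle, form_add_right, form_smul_right, hx.1, hxW]
    nlinarith [h.cos_pos hε' (k * t)]
  · rw [h.deriv_deriv_greatCircle, tangentProj, form_smul_right, hself]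
    rw [← sub_smul]
    convert! zero_smul ℝ _
    field_simp
    ring

theorem IsTrig.hasConstantSpeed_greatCircle (h : IsTrig ε C S I) {c : ℝ} {k r : ℝ} {x W : V} (hx : x ∈ spaceForm c)
    (hxW : form c x W = 0) (hW : form c W W = ε / c) (hr : k ^ 2 * (ε / c) = r) :
    HasConstantSpeed c (greatCircle C S k x W) (Real.sqrt r) := by
  intro t
  rw [h.deriv_greatCircle, ← hr]
  congr 1
  simp only [form_add_left, form_add_right, form_smul_left, form_smul_right,
      hx.1, hxW, form_comm c W x, hW]
  linear_combination (k ^ 2 * ε * (1 / c)) * h.cos_sq_add (k * t)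

/-- The coefficient determinant is `k (C² + ε S²) = k`: the cross product does not depend on `t`,
and the surface formula involves a single fixed normal. -/
theorem IsTrig.cross_greatCircle (h : IsTrig ε C S I) (k : ℝ) (x W : V) (t : ℝ) :
    cross ε (greatCircle C S k x W t) (deriv (greatCircle C S k x W) t) = k • cross ε x W := by
  rw [h.deriv_greatCircle, greatCircle, cross_combination]
  congr 1
  linear_combination k * h.cos_sq_add (k * t)

/-! ### Fermi coordinates -/

/-- The Fermi coordinates of a point of the space form, along the geodesic through `x` in the
direction `W`. -/
noncomputable def fermi (c ε k : ℝ) (I : ℝ → ℝ) (W N z : V) : E2 :=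
  -- Solving `z = C(ku) (C(kv) x + S(kv) W) + S(ku) N`: the `N`-coordinate is `S(ku)`, the root is
  -- `C(ku)`, and the `W`-coordinate is `C(ku) S(kv)`.
  !₂[I (ε * c * form c z N) / k,
    I (ε * c * form c z W / Real.sqrt (1 - ε * (ε * c * form c z N) ^ 2)) / k]

/-- The coordinates of `z` satisfy `a² + ε (b² + n²) = 1`. So `1 - ε n² = a² + ε b²`, positive on
the sphere since `a > 0` and on the hyperboloid since it is `1 + n²`; dividing by it gives the
second identity. -/
theorem IsAdaptedFrame.coord_pos {c : ℝ} {x W N : V} (hf : IsAdaptedFrame c ε x W N) (hc : c ≠ 0)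
    (hε : ε = 1 ∨ ε = -1) {z : V} (hz : z ∈ spaceForm c) (hzx : 0 < c * form c z x) :
    0 < 1 - ε * (ε * c * form c z N) ^ 2 ∧
    1 - ε * (ε * c * form c z W / Real.sqrt (1 - ε * (ε * c * form c z N) ^ 2)) ^ 2
      = ((c * form c z x) / Real.sqrt (1 - ε * (ε * c * form c z N) ^ 2)) ^ 2 := by
  have hεε : ε * ε = 1 := by rcases hε with rfl | rfl <;> norm_num
  have h1 := hf.exists_eq hc hεε z
  have h2 : c * form c z z = 1 := by rw [hz.1]; field_simp
  set a := c * form c z x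
  set b := ε * c * form c z W
  set n := ε * c * form c z N
  rw [h1, hf.form_combination hc] at h2
  have h3 : 0 < 1 - ε * n ^ 2 := by
    rcases hε with rfl | rfl
    · nlinarith [sq_nonneg b]
    · nlinarith [sq_nonneg n]
  refine ⟨h3, ?_⟩
  rw [div_pow, div_pow, Real.sq_sqrt h3.le]
  field_simp
  linear_combination -h2

theorem IsTrig.fermi_spec (h : IsTrig ε C S I) {c : ℝ} {x W N : V}
    (hf : IsAdaptedFrame c ε x W N) (hc : c ≠ 0) (hε : ε = 1 ∨ ε = -1) {k : ℝ} (hk : k ≠ 0) {z : V}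
    (hz : z ∈ spaceForm c) (hzx : 0 < c * form c z x) :
    C (k * fermi c ε k I W N z 0) • greatCircle C S k x W (fermi c ε k I W N z 1)
      + S (k * fermi c ε k I W N z 0) • N = z := by
  have hεε : ε * ε = 1 := by rcases hε with rfl | rfl <;> norm_num
  obtain ⟨h1, h2⟩ := hf.coord_pos hc hε hz hzx
  have hs := Real.sqrt_pos.mpr h1
  conv_rhs => rw [hf.exists_eq hc hεε z]
  simp only [fermi, greatCircle, Matrix.cons_val_zero, Matrix.cons_val_one, mul_div_cancel₀ _ hk]
  set a := c * form c z x
  set b := ε * c * form c z W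
  set n := ε * c * form c z N
  set r := Real.sqrt (1 - ε * n ^ 2)
  have h3 : 0 < 1 - ε * (b / r) ^ 2 := by rw [h2]; positivity
  -- The hemisphere condition `a > 0` fixes the sign of the root, so that `C(kv) = a / r`.
  have h4 : 0 ≤ a / r := by positivity
  rw [h.sin_inv n h1, h.cos_inv n h1, h.sin_inv _ h3, h.cos_inv _ h3, h2, Real.sqrt_sq h4,
    smul_add, smul_smul, smul_smul, mul_div_cancel₀ _ hs.ne', mul_div_cancel₀ _ hs.ne']

theorem contDiff_form_left (c : ℝ) (y : V) : ContDiff ℝ ∞ fun z => form c z y := by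
  simp only [← formL_apply]
  exact (formL c).contDiff.clm_apply contDiff_const

theorem IsTrig.contDiffAt_fermi (h : IsTrig ε C S I) {c : ℝ} {x W N : V}
    (hf : IsAdaptedFrame c ε x W N) (hc : c ≠ 0) (hε : ε = 1 ∨ ε = -1) (k : ℝ) {z : V}
    (hz : z ∈ spaceForm c) (hzx : 0 < c * form c z x) :
    ContDiffAt ℝ ∞ (fermi c ε k I W N) z := by
  obtain ⟨h1, h2⟩ := hf.coord_pos hc hε hz hzx
  have hs := Real.sqrt_pos.mpr h1
  have hN : ContDiffAt ℝ ∞ (fun z => ε * c * form c z N) z :=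
    contDiffAt_const.mul (contDiff_form_left c N).contDiffAt
  have hW : ContDiffAt ℝ ∞ (fun z => ε * c * form c z W) z :=
    contDiffAt_const.mul (contDiff_form_left c W).contDiffAt
  have hr : ContDiffAt ℝ ∞ (fun z => Real.sqrt (1 - ε * (ε * c * form c z N) ^ 2)) z :=
    (contDiffAt_const.sub (contDiffAt_const.mul (hN.pow 2))).sqrt h1.ne'
  have h3 : 0 < 1 - ε * (ε * c * form c z W
      / Real.sqrt (1 - ε * (ε * c * form c z N) ^ 2)) ^ 2 := by
    rw [h2]; positivity
  rw [contDiffAt_euclidean]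
  intro i
  fin_cases i
  · exact ((h.contDiffAt_inv _ h1).comp z hN).div_const k
  · exact ((h.contDiffAt_inv _ h3).comp z (hW.div hr hs.ne')).div_const k

end

/-! ### Charts of the surface -/

/-- A local diffeomorphism of the plane turns a chart into another chart. -/
theorem exists_chart_of_injective_fderiv {M : Type*} [TopologicalSpace M] [ChartedSpace E2 M]
    [IsManifold (𝓡 2) ∞ M] {χ : OpenPartialHomeomorph M E2}
    (hχ : χ ∈ IsManifold.maximalAtlas (𝓡 2) ∞ M) {p : M} (hp : p ∈ χ.source) {θ : E2 → E2}
    {W : Set E2} (hW : IsOpen W) (hpW : χ p ∈ W) (hθ : ∀ y ∈ W, ContDiffAt ℝ ∞ θ y)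
    (hinj : ∀ y ∈ W, Function.Injective (fderiv ℝ θ y)) :
    ∃ χ' ∈ IsManifold.maximalAtlas (𝓡 2) ∞ M, p ∈ χ'.source ∧
      ∀ q ∈ χ'.source, q ∈ χ.source ∧ χ q ∈ W ∧ χ' q = θ (χ q) := by
  have hne : (∞ : WithTop ℕ∞) ≠ 0 := by simp
  have hequiv : ∀ y ∈ W, ∃ e : E2 ≃L[ℝ] E2, HasFDerivAt θ (e : E2 →L[ℝ] E2) y := by
    intro y hy
    refine ⟨(LinearEquiv.ofInjectiveEndo (fderiv ℝ θ y : E2 →ₗ[ℝ] E2)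
      (hinj y hy)).toContinuousLinearEquiv, ?_⟩
    convert! ((hθ y hy).differentiableAt hne).hasFDerivAt
  obtain ⟨e₀, he₀⟩ := hequiv _ hpW
  -- Restricting the local inverse to `W`, where every derivative of `θ` is invertible, makes it
  -- smooth on its whole domain and not just at one point.
  set e := ((hθ _ hpW).toOpenPartialHomeomorph θ he₀ hne).restrOpen W hW with he
  have hcoe : ∀ y, e y = θ y := fun _ => rfl
  have hsrc : e.source ⊆ W := fun y hy => hy.2
  have hmem : χ p ∈ e.source :=
    ⟨(hθ _ hpW).mem_toOpenPartialHomeomorph_source he₀ hne, hpW⟩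
  have hsymm : ∀ y ∈ e.target, ContDiffAt ℝ ∞ e.symm y := by
    intro y hy
    have h := hsrc (e.map_target hy)
    obtain ⟨e₁, he₁⟩ := hequiv _ h
    exact e.contDiffAt_symm hy he₁ (hθ _ h)
  refine ⟨χ.trans e, ?_, ⟨hp, hmem⟩, fun q hq => ⟨hq.1, hsrc hq.2, rfl⟩⟩
  refine OpenPartialHomeomorph.mem_maximalAtlas_of_contMDiffOn _ ?_ ?_
  · intro q hq
    have h1 := contMDiffAt_of_mem_maximalAtlas hχ hq.1
    exact ((hθ _ (hsrc hq.2)).contMDiffAt.comp q h1).contMDiffWithinAt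
  · intro y hy
    rw [OpenPartialHomeomorph.trans_target] at hy
    have h1 := contMDiffAt_symm_of_mem_maximalAtlas hχ hy.2
    exact (h1.comp y (hsymm y hy.1).contMDiffAt).contMDiffWithinAt

section Chart

variable {M : Type*} [TopologicalSpace M] [ChartedSpace E2 M]
  {c₁ c₂ : ℝ} {ψ : M → A}

theorem IsImmersedSurface.contDiffAt_chart (hψ : IsImmersedSurface c₁ c₂ ψ)
    {χ : OpenPartialHomeomorph M E2} (hχ : χ ∈ IsManifold.maximalAtlas (𝓡 2) ∞ M) {y : E2}
    (hy : y ∈ χ.target) : ContDiffAt ℝ ∞ (ψ ∘ χ.symm) y := by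
  rw [← contMDiffAt_iff_contDiffAt]
  exact (hψ.smooth (χ.symm y)).comp y (contMDiffAt_symm_of_mem_maximalAtlas hχ hy)

/-- The differential in a chart is, up to a change of coordinates, the differential of `ψ`. -/
theorem IsImmersedSurface.fderiv_chart [IsManifold (𝓡 2) ∞ M] (hψ : IsImmersedSurface c₁ c₂ ψ)
    {χ : OpenPartialHomeomorph M E2} (hχ : χ ∈ IsManifold.maximalAtlas (𝓡 2) ∞ M) {y : E2}
    (hy : y ∈ χ.target) : ∃ (D : E2 →L[ℝ] A) (e : E2 ≃L[ℝ] E2), Function.Injective D ∧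
      eigenvaluesF c₁ c₂ D = eigenvaluesAt c₁ c₂ ψ (χ.symm y) ∧
      fderiv ℝ (ψ ∘ χ.symm) y = D ∘L (e : E2 →L[ℝ] E2) := by
  have hne : (∞ : WithTop ℕ∞) ≠ 0 := by simp
  have hs : MDifferentiableAt (𝓡 2) (𝓡 2) χ.symm y :=
    (contMDiffAt_symm_of_mem_maximalAtlas hχ hy).mdifferentiableAt hne
  have hc : MDifferentiableAt (𝓡 2) (𝓡 2) χ (χ.symm y) :=
    (contMDiffAt_of_mem_maximalAtlas hχ (χ.map_target hy)).mdifferentiableAt hne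
  have hψd : MDifferentiableAt (𝓡 2) 𝓘(ℝ, A) ψ (χ.symm y) := (hψ.smooth _).mdifferentiableAt hne
  let S : E2 →L[ℝ] E2 := mfderiv (𝓡 2) (𝓡 2) χ.symm y
  let S' : E2 →L[ℝ] E2 := mfderiv (𝓡 2) (𝓡 2) χ (χ.symm y)
  have hid : ∀ X, S' (S X) = X := by
    have h1 := hc.hasMFDerivAt.comp y hs.hasMFDerivAt
    have h2 : HasMFDerivAt (𝓡 2) (𝓡 2) (χ ∘ χ.symm) y _ :=
      (hasMFDerivAt_id (I := 𝓡 2) y).congr_of_eventuallyEq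
        (by filter_upwards [χ.open_target.mem_nhds hy] with z hz using χ.right_inv hz)
    exact fun X => congrArg (fun T : E2 →L[ℝ] E2 => T X) (hasMFDerivAt_unique h1 h2)
  refine ⟨mfderiv (𝓡 2) 𝓘(ℝ, A) ψ (χ.symm y),
    (LinearEquiv.ofInjectiveEndo (S : E2 →ₗ[ℝ] E2)
      (Function.LeftInverse.injective hid)).toContinuousLinearEquiv, hψ.immersive _, rfl, ?_⟩
  rw [← mfderiv_eq_fderiv, mfderiv_comp y hψd hs]
  ext X; all_goals rfl

/-- In a chart, a surface whose endomorphism `f` is `(c₂ - c₁) / (c₁ + c₂)` times the identity has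
homothetic projections. -/
theorem IsImmersedSurface.form_chart [IsManifold (𝓡 2) ∞ M] (hψ : IsImmersedSurface c₁ c₂ ψ) (hc : 0 < c₁ * c₂)
    (hlam : ∀ p, eigenvaluesAt c₁ c₂ ψ p = {(c₂ - c₁) / (c₁ + c₂), (c₂ - c₁) / (c₁ + c₂)})
    {χ : OpenPartialHomeomorph M E2} (hχ : χ ∈ IsManifold.maximalAtlas (𝓡 2) ∞ M) {y : E2}
    (hy : y ∈ χ.target) :
    Function.Injective (fderiv ℝ (ψ ∘ χ.symm) y) ∧
    (∀ X, fderiv ℝ (ψ ∘ χ.symm) y X ∈ prodTangent c₁ c₂ (ψ (χ.symm y))) ∧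
    ∀ X Y, c₁ * form c₁ (fderiv ℝ (ψ ∘ χ.symm) y X).1 (fderiv ℝ (ψ ∘ χ.symm) y Y).1
      = c₂ * form c₂ (fderiv ℝ (ψ ∘ χ.symm) y X).2 (fderiv ℝ (ψ ∘ χ.symm) y Y).2 := by
  have hc₁ : c₁ ≠ 0 := by rintro rfl; simp at hc
  have hc₂ : c₂ ≠ 0 := by rintro rfl; simp at hc
  obtain ⟨D, e, hinj, hl, he⟩ := hψ.fderiv_chart hχ hy
  have htan : ∀ X, fderiv ℝ (ψ ∘ χ.symm) y X ∈ prodTangent c₁ c₂ (ψ (χ.symm y)) := by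
    intro X
    have hd := ((hψ.contDiffAt_chart hχ hy).differentiableAt (by simp)).hasFDerivAt
    have h1 := (ContinuousLinearMap.fst ℝ V V).hasFDerivAt.comp y hd
    have h2 := (ContinuousLinearMap.snd ℝ V V).hasFDerivAt.comp y hd
    have e1 := form_add_form_eq_zero (c := c₁) h1 h1
      (Filter.Eventually.of_forall fun z => (hψ.mem (χ.symm z)).1.1) X
    have e2 := form_add_form_eq_zero (c := c₂) h2 h2
      (Filter.Eventually.of_forall fun z => (hψ.mem (χ.symm z)).2.1) X
    rw [form_comm _ (((ContinuousLinearMap.fst ℝ V V) ∘L fderiv ℝ (ψ ∘ χ.symm) y) X)] at e1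
    rw [form_comm _ (((ContinuousLinearMap.snd ℝ V V) ∘L fderiv ℝ (ψ ∘ χ.symm) y) X)] at e2
    exact ⟨self_eq_neg.mp (eq_neg_of_add_eq_zero_left e1),
      self_eq_neg.mp (eq_neg_of_add_eq_zero_left e2)⟩
  have hpos : ∀ X, X ≠ 0 → 0 < metric c₁ c₂ (D X) (D X) := by
    intro X hX
    refine metric_self_pos hc₁ hc₂ (hψ.mem (χ.symm y)) ?_
      (fun h => hX ((injective_iff_map_eq_zero _).mp hinj X h))
    have := htan (e.symm X)
    rw [he, ContinuousLinearMap.comp_apply, ContinuousLinearEquiv.coe_coe,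
      e.apply_symm_apply] at this
    exact this
  refine ⟨?_, htan, fun X Y => ?_⟩
  · rw [he]
    exact hinj.comp e.injective
  · rw [he]
    exact form_fst_eq_form_snd hc hpos (hl.trans (hlam _)) (e X) (e Y)

end Chart

/-! ### Assembling the normal form -/

/-- By Lagrange's identity `x × W` has squared length `1 / c²`, so a factor with square `ε c` gives
it the length of `W`. -/
theorem isAdaptedFrame_cross {c ε m : ℝ} (hc : c ≠ 0) (hε : ε = if 0 < c then 1 else -1) {x W : V}
    (hx : x ∈ spaceForm c) (hxW : form c x W = 0) (hW : form c W W = ε / c) (hm : m ^ 2 = ε * c) :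
    IsAdaptedFrame c ε x W (m • cross ε x W) where
  mem := hx
  form_W := hW
  form_N := by
    have hεε : ε * ε = 1 := by rw [hε]; split_ifs <;> norm_num
    rw [form_smul_left, form_smul_right, form_cross_cross hε, hx.1, hW, hxW]
    field_simp
    linear_combination (ε ^ 2) * hm + (c * ε) * hεε
  form_x_W := hxW
  form_x_N := by rw [form_smul_right, form_comm, form_cross_left hε, mul_zero]
  form_W_N := by rw [form_smul_right, form_comm, form_cross_right hε, mul_zero]

/-- Rescaling of a tangent vector to the length of the position vector. -/
theorem exists_smul_form_eq {c ε : ℝ} (hc : c ≠ 0) (hε : ε = if 0 < c then 1 else -1) {x w : V}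
    (hx : x ∈ spaceForm c) (hxw : form c x w = 0) (hw : w ≠ 0) :
    ∃ W : V, form c x W = 0 ∧ form c W W = ε / c := by
  have hpos := form_self_pos hc hx hxw hw
  have hεc : 0 < ε / c := by
    rw [hε]
    split_ifs with h
    · positivity
    · exact div_pos_of_neg_of_neg (by norm_num) (lt_of_le_of_ne (not_lt.mp h) hc)
  refine ⟨Real.sqrt (ε / c / form c w w) • w, ?_, ?_⟩
  · rw [form_smul_right, hxw, mul_zero]
  · rw [form_smul_left, form_smul_right, ← mul_assoc, Real.mul_self_sqrt (by positivity)]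
    field_simp

/-- Equal signs of the curvatures give the same scalar product, `s²` turns `1/c₁` into `1/c₂`, and
`s > 0` preserves the sheet. -/
theorem mem_spaceForm_of_smul {c₁ c₂ s : ℝ} (hc : 0 < c₁ * c₂) (hs : 0 < s) (hs2 : s ^ 2 = c₁ / c₂)
    {x : V} (hx : x ∈ spaceForm c₁) : s • x ∈ spaceForm c₂ := by
  have hc₁ : c₁ ≠ 0 := by rintro rfl; simp at hc
  have hc₂ : c₂ ≠ 0 := by rintro rfl; simp at hc
  refine ⟨?_, fun h => ?_⟩
  · rw [form_smul_left, form_smul_right, form_congr hc, hx.1, ← mul_assoc, ← sq, hs2]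
    field_simp
  · have : 0 < x 0 := hx.2 (by nlinarith)
    simpa using mul_pos hs this

/-- The local normal form, for both signs of the curvatures at once. -/
theorem exists_local_parametrization {ε : ℝ} {C S I : ℝ → ℝ} (h : IsTrig ε C S I) {c₁ c₂ : ℝ}
    (hc : 0 < c₁ * c₂) (hε : ε = if 0 < c₁ then 1 else -1) {k : ℝ}
    (hk : k = Real.sqrt (ε * (c₁ * c₂ / (c₁ + c₂))))
    {M : Type*} [TopologicalSpace M] [ChartedSpace E2 M] [IsManifold (𝓡 2) ∞ M] {ψ : M → A}
    (hψ : IsImmersedSurface c₁ c₂ ψ) (hgeod : IsTotallyGeodesic c₁ c₂ ψ)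
    (hlam : ∀ p, eigenvaluesAt c₁ c₂ ψ p = {(c₂ - c₁) / (c₁ + c₂), (c₂ - c₁) / (c₁ + c₂)})
    (p : M) : ∃ (τ : A → A) (α β : ℝ → V), IsIsometry c₁ c₂ τ ∧
      IsGeodesic c₁ α ∧ HasConstantSpeed c₁ α (Real.sqrt (c₂ / (c₁ + c₂))) ∧
      IsGeodesic c₂ β ∧ HasConstantSpeed c₂ β (Real.sqrt (c₁ / (c₁ + c₂))) ∧
      IsLocallyGivenBy (τ ∘ ψ) p fun u v =>
        (C (k * u) • α v
            + (S (k * u) * Real.sqrt ((c₁ + c₂) / c₂)) • cross ε (α v) (deriv α v),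
         C (k * u) • β v
            + (S (k * u) * Real.sqrt ((c₁ + c₂) / c₁)) • cross ε (β v) (deriv β v)) := by
  have hc₁ : c₁ ≠ 0 := by rintro rfl; simp at hc
  have hc₂ : c₂ ≠ 0 := by rintro rfl; simp at hc
  have hε1 : ε = 1 ∨ ε = -1 := by rw [hε]; split_ifs <;> simp
  have hεε : ε * ε = 1 := by rcases hε1 with h | h <;> rw [h] <;> norm_num
  have hε₂ : ε = if 0 < c₂ then 1 else -1 := by
    rw [hε]
    congr 1
    exact propext ⟨fun h => by nlinarith, fun h => by nlinarith⟩
  have p₁ : 0 < ε * c₁ := by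
    rw [hε]
    split_ifs with h
    · linarith
    · linarith [lt_of_le_of_ne (not_lt.mp h) hc₁]
  have p₂ : 0 < ε * c₂ := by
    rw [hε₂]
    split_ifs with h
    · linarith
    · linarith [lt_of_le_of_ne (not_lt.mp h) hc₂]
  have hε0 : ε ≠ 0 := by rintro rfl; simp at hεε
  have hs0 : c₁ + c₂ ≠ 0 := by
    intro h0
    have : ε * c₁ + ε * c₂ = 0 := by rw [← mul_add, h0, mul_zero]
    linarith
  have q₁ : 0 < (c₁ + c₂) / c₁ := by
    rw [← mul_div_mul_left _ _ hε0, mul_add]; positivity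
  have q₂ : 0 < (c₁ + c₂) / c₂ := by
    rw [← mul_div_mul_left _ _ hε0, mul_add]; positivity
  have q₁₂ : 0 < c₁ / c₂ := by
    rw [← mul_div_mul_left _ _ hε0]; positivity
  have qk : 0 < ε * (c₁ * c₂ / (c₁ + c₂)) := by
    have : ε * (c₁ * c₂ / (c₁ + c₂)) = (ε * c₁) / ((c₁ + c₂) / c₂) := by field_simp
    rw [this]; positivity
  have hk0 : 0 < k := by rw [hk]; exact Real.sqrt_pos.mpr qk
  have hk2 : k ^ 2 = ε * (c₁ * c₂ / (c₁ + c₂)) := by rw [hk, Real.sq_sqrt qk.le]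
  set s := Real.sqrt (c₁ / c₂) with hs
  have hsp : 0 < s := Real.sqrt_pos.mpr q₁₂
  have hs2 : s ^ 2 = c₁ / c₂ := Real.sq_sqrt q₁₂.le
  -- the surface is locally the graph of a linear homothety
  set χ := chartAt E2 p with hχdef
  have hχ : χ ∈ IsManifold.maximalAtlas (𝓡 2) ∞ M := IsManifold.chart_mem_maximalAtlas p
  have hpχ : p ∈ χ.source := mem_chart_source E2 p
  obtain ⟨r, hr, hball⟩ := Metric.isOpen_iff.mp χ.open_target _ (χ.map_source hpχ)
  -- A ball is convex, as the constancy argument for moving frames requires.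
  set U := Metric.ball (χ p) r
  have hpU : χ p ∈ U := Metric.mem_ball_self hr
  obtain ⟨Q, hQ, hQform⟩ := exists_homothety hc₁ hc₂ (Φ := ψ ∘ χ.symm) (U := U)
    Metric.isOpen_ball (convex_ball _ _) ⟨_, hpU⟩
    (fun y hy => (hψ.contDiffAt_chart hχ (hball hy)).contDiffWithinAt)
    (fun y _ => hψ.mem _)
    (fun y hy => (hψ.form_chart hc hlam hχ (hball hy)).1)
    (fun y hy => (hψ.form_chart hc hlam hχ (hball hy)).2.2)
    (fun y hy => hgeod χ (chart_mem_atlas E2 p) y (hball hy))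
  -- Both `Q` and the dilation by `s` scale the form by `c₁ / c₂`, so `s Q⁻¹` is an isometry; it
  -- replaces the graph of `Q` by that of the dilation.
  let L : V ≃L[ℝ] V := Q.symm.trans (ContinuousLinearEquiv.smulLeft (Units.mk0 s hsp.ne'))
  have hL : ∀ x, L (Q x) = s • x := fun x => by
    change s • Q.symm (Q x) = s • x
    rw [Q.symm_apply_apply]
  have hLform : ∀ x y, form c₂ (L x) (L y) = form c₂ x y := by
    intro x y
    obtain ⟨x, rfl⟩ := Q.surjective x
    obtain ⟨y, rfl⟩ := Q.surjective y
    have := hQform x y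
    rw [hL, hL, form_smul_left, form_smul_right, ← mul_assoc, ← sq, hs2,
      congrFun (congrFun (form_congr hc) x) y]
    field_simp
    linarith
  set x₀ := (ψ p).1 with hx₀def
  have hx₀ : x₀ ∈ spaceForm c₁ := (hψ.mem p).1
  have hψp : (ψ p).2 = Q x₀ := by
    have := hQ _ hpU
    simpa [χ.left_inv hpχ] using this
  have hτ := isIsometry_prodMap (c₁ := c₁) (L := L) hLform (hψ.mem p).2
    (by rw [hψp, hL]; exact mem_spaceForm_of_smul hc hsp hs2 hx₀)
  -- a frame at the base point
  obtain ⟨W, hxW, hW⟩ : ∃ W : V, form c₁ x₀ W = 0 ∧ form c₁ W W = ε / c₁ := by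
    obtain ⟨himm, htan, hconf⟩ := hψ.form_chart hc hlam hχ (hball hpU)
    set X := fderiv ℝ (ψ ∘ χ.symm) (χ p) (EuclideanSpace.single 0 1) with hX
    have htX := htan (EuclideanSpace.single 0 1)
    have hcX := hconf (EuclideanSpace.single 0 1) (EuclideanSpace.single 0 1)
    rw [← hX, χ.left_inv hpχ] at htX
    rw [← hX] at hcX
    refine exists_smul_form_eq hc₁ hε hx₀ htX.1 (fun h1 => ?_)
    have h2 : X.2 = 0 := by
      by_contra hne
      have := form_self_pos hc₂ (hψ.mem p).2 htX.2 hne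
      rw [h1, form_zero_left, mul_zero, eq_comm, mul_eq_zero] at hcX
      exact this.ne' (hcX.resolve_left hc₂)
    have h3 := (injective_iff_map_eq_zero _).mp himm (EuclideanSpace.single 0 1) (Prod.ext h1 h2)
    simp at h3
  -- The prescribed coefficient times the `k` coming from `α × α'`; its square `ε c₁` is exactly
  -- what an adapted frame needs.
  set m := Real.sqrt ((c₁ + c₂) / c₂) * k with hm
  have hm2 : m ^ 2 = ε * c₁ := by
    rw [hm, mul_pow, Real.sq_sqrt q₂.le, hk2]
    field_simp
  have hf := isAdaptedFrame_cross hc₁ hε hx₀ hxW hW hm2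
  set N := m • cross ε x₀ W with hN
  set α := greatCircle C S k x₀ W with hα
  have hβ : s • α = greatCircle C S k (s • x₀) (s • W) := smul_greatCircle s k x₀ W
  have hsx₀ : s • x₀ ∈ spaceForm c₂ := mem_spaceForm_of_smul hc hsp hs2 hx₀
  have hsxW : form c₂ (s • x₀) (s • W) = 0 := by
    rw [form_smul_left, form_smul_right, form_congr hc, hxW, mul_zero, mul_zero]
  have hsW : form c₂ (s • W) (s • W) = ε / c₂ := by
    rw [form_smul_left, form_smul_right, form_congr hc, hW, ← mul_assoc, ← sq, hs2]
    field_simp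
  -- the two components of the model surface
  have hfst : ∀ u v, C (k * u) • α v
      + (S (k * u) * Real.sqrt ((c₁ + c₂) / c₂)) • cross ε (α v) (deriv α v)
      = C (k * u) • α v + S (k * u) • N := by
    intro u v
    rw [hα, h.cross_greatCircle, hN, hm]
    module
  have hroot : Real.sqrt ((c₁ + c₂) / c₂) = s * Real.sqrt ((c₁ + c₂) / c₁) := by
    rw [hs, ← Real.sqrt_mul q₁₂.le]
    congr 1
    field_simp
  -- The cross product contributes `s²`: one `s` is the common factor, the other converts the root
  -- over `c₁` into the root over `c₂`.
  have hsnd : ∀ u v, C (k * u) • (s • α) v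
      + (S (k * u) * Real.sqrt ((c₁ + c₂) / c₁)) • cross ε ((s • α) v) (deriv (s • α) v)
      = s • (C (k * u) • α v + S (k * u) • N) := by
    intro u v
    rw [hβ, h.cross_greatCircle, cross_smul_smul, ← hβ, hN, hm, hroot, Pi.smul_apply]
    module
  refine ⟨_, α, s • α, hτ, h.isGeodesic_greatCircle hc₁ hε k hx₀ hxW hW,
    h.hasConstantSpeed_greatCircle hx₀ hxW hW ?_, ?_, ?_, ?_⟩
  · rw [hk2]
    field_simp
    linear_combination hεε
  · rw [hβ]
    exact h.isGeodesic_greatCircle hc₂ hε₂ k hsx₀ hsxW hsW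
  · rw [hβ]
    refine h.hasConstantSpeed_greatCircle hsx₀ hsxW hsW ?_
    rw [hk2]
    field_simp
    linear_combination hεε
  simp only [hfst, hsnd]
  -- local coordinates
  set φ : E2 → V := fun y => (ψ (χ.symm y)).1 with hφ
  have hφU : ∀ y ∈ U, ContDiffAt ℝ ∞ φ y := fun y hy =>
    contDiff_fst.contDiffAt.comp y (hψ.contDiffAt_chart hχ (hball hy))
  have hφcont : ContinuousOn (fun y => c₁ * form c₁ (φ y) x₀) U := by
    intro y hy
    exact (continuousAt_const.mul
      ((contDiff_form_left c₁ x₀).continuous.continuousAt.comp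
        (hφU y hy).continuousAt)).continuousWithinAt
  -- The points whose projection lies in the open hemisphere about `x₀`; for negative curvature the
  -- condition always holds.
  set O : Set E2 := U ∩ (fun y => c₁ * form c₁ (φ y) x₀) ⁻¹' Set.Ioi 0 with hO
  have hOopen : IsOpen O := hφcont.isOpen_inter_preimage Metric.isOpen_ball isOpen_Ioi
  have hpO : χ p ∈ O := by
    refine ⟨hpU, ?_⟩
    have : φ (χ p) = x₀ := by rw [hφ]; simp only [χ.left_inv hpχ]; rfl
    change 0 < c₁ * form c₁ (φ (χ p)) x₀
    rw [this, hx₀.1, mul_one_div_cancel hc₁]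
    exact one_pos
  set θ : E2 → E2 := fun y => fermi c₁ ε k I W N (φ y) with hθ
  have hθsmooth : ∀ y ∈ O, ContDiffAt ℝ ∞ θ y := fun y hy =>
    ContDiffAt.comp (g := fermi c₁ ε k I W N) y
      (h.contDiffAt_fermi hf hc₁ hε1 k (hψ.mem _).1 hy.2) (hφU y hy.1)
  have hspec : ∀ y ∈ O, C (k * θ y 0) • α (θ y 1) + S (k * θ y 0) • N = φ y := fun y hy =>
    h.fermi_spec hf hc₁ hε1 hk0.ne' (hψ.mem _).1 hy.2
  have hinj : ∀ y ∈ O, Function.Injective (fderiv ℝ θ y) := by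
    intro y hy
    -- Near `y` the immersion factors as `Ξ ∘ θ`, so `dθ` inherits injectivity without any
    -- computation of its Jacobian.
    set Ξ : E2 → A := fun z => (C (k * z 0) • α (z 1) + S (k * z 0) • N,
      Q (C (k * z 0) • α (z 1) + S (k * z 0) • N)) with hΞ
    have hΞd : DifferentiableAt ℝ Ξ (θ y) := by
      have hp0 : ContDiff ℝ ∞ (fun z : E2 => k * z 0) := by fun_prop
      have hp1 : ContDiff ℝ ∞ (fun z : E2 => z 1) := by fun_prop
      have h1 : ContDiff ℝ ∞ (fun z : E2 => C (k * z 0) • α (z 1) + S (k * z 0) • N) :=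
        ((h.contDiff_cos.comp hp0).smul ((h.contDiff_greatCircle k x₀ W).comp hp1)).add
          ((h.contDiff_sin.comp hp0).smul contDiff_const)
      exact (h1.prodMk (Q.contDiff.comp h1)).contDiffAt.differentiableAt (by simp)
    have hev : ψ ∘ χ.symm =ᶠ[nhds y] Ξ ∘ θ := by
      filter_upwards [hOopen.mem_nhds hy] with z hz
      have h2 := hQ z hz.1
      simp only [hΞ, Function.comp_apply, hspec z hz]
      exact Prod.ext rfl h2
    have hcomp : fderiv ℝ (ψ ∘ χ.symm) y = fderiv ℝ Ξ (θ y) ∘L fderiv ℝ θ y := by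
      rw [hev.fderiv_eq, fderiv_comp y hΞd ((hθsmooth y hy).differentiableAt (by simp))]
    have himm := (hψ.form_chart hc hlam hχ (hball hy.1)).1
    rw [hcomp] at himm
    exact Function.Injective.of_comp (f := fderiv ℝ Ξ (θ y)) himm
  obtain ⟨χ', hχ', hpχ', hq⟩ :=
    exists_chart_of_injective_fderiv hχ hpχ hOopen hpO hθsmooth hinj
  refine ⟨χ', hχ', hpχ', fun q hqs => ?_⟩
  obtain ⟨hqχ, hqO, hqθ⟩ := hq q hqs
  have h1 := hspec _ hqO
  have h2 := hQ _ hqO.1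
  simp only [hφ, Function.comp_apply, χ.left_inv hqχ] at h1 h2
  rw [hqθ]
  beta_reduce
  rw [h1]
  exact Prod.ext rfl (by rw [← hL, ← h2]; rfl)

end SpaceFormProduct

open SpaceFormProduct in
theorem mainTheorem11 (c₁ c₂ : ℝ) (hc : 0 < c₁ * c₂)
    {M : Type*} [TopologicalSpace M] [ChartedSpace (EuclideanSpace ℝ (Fin 2)) M]
    [IsManifold (𝓡 2) ∞ M] (ψ : M → (Fin 3 → ℝ) × (Fin 3 → ℝ))
    (hψ : IsImmersedSurface c₁ c₂ ψ)
    (hgeod : IsTotallyGeodesic c₁ c₂ ψ)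
    (hlam : ∀ p, eigenvaluesAt c₁ c₂ ψ p = {(c₂ - c₁) / (c₁ + c₂), (c₂ - c₁) / (c₁ + c₂)}) :
    (0 < c₁ → 0 < c₂ → ∀ p : M, ∃ (τ : (Fin 3 → ℝ) × (Fin 3 → ℝ) → (Fin 3 → ℝ) × (Fin 3 → ℝ))
      (α β : ℝ → Fin 3 → ℝ),
      IsIsometry c₁ c₂ τ ∧
      IsGeodesic c₁ α ∧ HasConstantSpeed c₁ α (Real.sqrt (c₂ / (c₁ + c₂))) ∧
      IsGeodesic c₂ β ∧ HasConstantSpeed c₂ β (Real.sqrt (c₁ / (c₁ + c₂))) ∧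
      IsLocallyGivenBy (τ ∘ ψ) p (sphericalSurface c₁ c₂ α β)) ∧
    (c₁ < 0 → c₂ < 0 → ∀ p : M, ∃ (τ : (Fin 3 → ℝ) × (Fin 3 → ℝ) → (Fin 3 → ℝ) × (Fin 3 → ℝ))
      (α β : ℝ → Fin 3 → ℝ),
      IsIsometry c₁ c₂ τ ∧
      IsGeodesic c₁ α ∧ HasConstantSpeed c₁ α (Real.sqrt (c₂ / (c₁ + c₂))) ∧
      IsGeodesic c₂ β ∧ HasConstantSpeed c₂ β (Real.sqrt (c₁ / (c₁ + c₂))) ∧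
      IsLocallyGivenBy (τ ∘ ψ) p (hyperbolicSurface c₁ c₂ α β)) := by
  constructor
  · intro h₁ h₂ p
    obtain ⟨τ, α, β, hτ, hα, hα', hβ, hβ', hS⟩ :=
      exists_local_parametrization isTrig_circular hc (by rw [if_pos h₁]) rfl hψ hgeod hlam p
    refine ⟨τ, α, β, hτ, hα, hα', hβ, hβ', ?_⟩
    convert! hS using 1
    funext u v
    rw [sphericalSurface, euclCross_eq, one_mul]
  · intro h₁ h₂ p
    obtain ⟨τ, α, β, hτ, hα, hα', hβ, hβ', hS⟩ :=
      exists_local_parametrization isTrig_hyperbolic hc (by rw [if_neg h₁.not_gt]) rfl hψ hgeod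
        hlam p
    refine ⟨τ, α, β, hτ, hα, hα', hβ, hβ', ?_⟩
    convert! hS using 1
    funext u v
    rw [hyperbolicSurface, lorentzCross_eq, neg_one_mul]
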